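/- **Online algorithms.** A randomized online algorithm draws a random seed; its output at time $j$ is a function of the seed and of the inputs received at times up to $j$. **Continuous OCS.** For a nonempty finite set $L$, a continuous OCS on $L$ is a randomized online algorithm that at each time step $j\in\mathbb N$ receives a probability vector $p^{(j)}$ on $L$ and irrevocably selects a winner in $L$. For $r\ge 0$ and $f:\mathbb R_{\ge 0}\to[0,1]$ it is an $(f,r)$-continuous OCS if there is a real-valued function $\mathcal F(S,p)$ of finite sets $S\subseteq\mathbb N$ and sequences $p\in[0,1]^{\mathbb N}$ such that, for every fixed sequence $p^{(0)},p^{(1)},\dots$ of probability vectors, every $i\in L$ and every finite $S$, $$\Pr[i\text{ never wins at a time step in }S]\le \mathcal F\big(S,((p^{(j)})_i)_{j}\big),$$ and such that for all $p\in[0,1]^{\mathbb N}$: 1. $\mathcal F(S,p)\le f\big(\sum_{j\in S}p_j\big)$ if $S=\{j_1,j_1+1,\dots,j_2\}$ with $j_1\le j_2$; 2. for all finite $S_1,S_2$ whose elements satisfy $j_1<j_2$ for $j_1\in S_1$, $j_2\in S_2$, and every time step $s$ with $j_1<s<j_2$ for all such $j_1,j_2$ (every element of $S_1$ is smaller and every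 element of $S_2$ larger than $s$), with $w=\max(1-r\,p_s,0)$, $$\mathcal F(S_1\cup S_2,p)\le w\,\mathcal F\big(S_1\cup(S_2-1),\mathrm{del}_s p\big)+(1-w)\,\mathcal F(S_1,p)\,\mathcal F(S_2,p),$$ where $S_2-1=\{j-1: j\in S_2\}$ and $\mathrm{del}_s p$ is $p$ with its entry at $s$ removed ($(\mathrm{del}_s p)_j=p_j$ for $j<s$ and $p_{j+1}$ for $j\ge s$). **Edge-weighted online bipartite matching (free disposal).** A finite set $L$ of offline vertices is known in advance. Online vertices $j=1,\dots,T$ arrive one by one ($T$ is unknown); on the arrival of $j$ the weights $w_{ij}\ge 0$, $i\in L$, are revealed ($0$ means no edge) and the algorithm irrevocably matches $j$ to some $i\in L$ or discards it. An offline vertex may be matched several times; the total weight is $\sum_{i\in L}\max\{w_{ij}: j\text{ matched to }i\}$, a maximum over the empty set being $0$. A randomized online algorithm is $\Gamma$-competitive if on every instance its expected total weight is at least $\Gamma$ times the optimal total weight with hindsight. **Theorem.** Let $f:\mathbb R_{\ge0}\to[0,1]$ be three times differentiable (one-sidedly at $0$) and convex, with log-concave derivative, meaning $f'''(x)f'(x)\le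 f''(x)^2$ for all $x\ge 0$, and with $\lim_{x\to\infty}f(x)=0$. Let $$\Gamma=1-\int_0^\infty e^{-t}f(t)\,dt,$$ and let $r\ge 0$ satisfy $$r\le\frac{-f'(0)-\Gamma}{\Gamma+(1-\Gamma)f'(0)},$$ where this condition is void if the denominator is $0$. If for every nonempty finite set $L$ there is an $(f,r)$-continuous OCS on $L$, then for every finite set $L$ of offline vertices there is a $\Gamma$-competitive algorithm for edge-weighted online bipartite matching. -/

import Mathlib

open MeasureTheory Set Filter Topology
open scoped NNReal

/-- A randomized online algorithm with input alphabet `I` and output alphabet `O` (finite in all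
uses). It draws a random seed `ω` from a probability space; its (irrevocable) output at time `j` is a
function of the seed and of the inputs number `0, …, j` only. -/
structure OnlineAlgorithm (I O : Type) where
  Ω : Type
  [mΩ : MeasurableSpace Ω]
  μ : Measure Ω
  [isProb : IsProbabilityMeasure μ]
  act : (j : ℕ) → (Fin (j + 1) → I) → Ω → O
  measurableSet_act : ∀ j x o, MeasurableSet (act j x ⁻¹' {o})

attribute [instance] OnlineAlgorithm.mΩ OnlineAlgorithm.isProb

namespace OnlineAlgorithm

variable {I O : Type}

/-- Output at time `j` on the infinite input sequence `x`, as a random variable. -/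
def output (A : OnlineAlgorithm I O) (x : ℕ → I) (j : ℕ) (ω : A.Ω) : O :=
  A.act j (fun k => x k) ω

/-- The random sequence of outputs on a finite input sequence `x` of length `T`. The algorithm is
not told `T`. -/
def outputs (A : OnlineAlgorithm I O) {T : ℕ} (x : Fin T → I) (ω : A.Ω) : Fin T → O :=
  fun j => A.act j (fun k => x (Fin.castLE j.isLt k)) ω

end OnlineAlgorithm

/-! ### Continuous online correlated selection -/

/-- A continuous OCS on the ground set `L`: at each time step it receives a probability vector on
`L` and selects a winner in `L`. -/
abbrev ContinuousOCS (L : Type) [Fintype L] : Type 1 :=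
  OnlineAlgorithm (stdSimplex ℝ L) L

/-- The sequence `p` with the entry at time `s` deleted. -/
def delSeq (s : ℕ) (p : ℕ → ℝ) : ℕ → ℝ := fun j => if j < s then p j else p (j + 1)

/-- The set of time steps obtained from `S₁ ∪ S₂` when a time step after `S₁` and before `S₂` is
deleted. -/
def delSet (S₁ S₂ : Finset ℕ) : Finset ℕ := S₁ ∪ S₂.image (fun j => j - 1)

/-- The two rules for the bound `𝓕 S p` on the probability that an element with selection
probabilities `p 0, p 1, …` never wins during `S`: consecutive time steps are bounded through `f`,
and a time step `s` in a gap is ignored with probability `w = (1 - r * p s)₊`. -/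
structure IsOCSBound (f : ℝ → ℝ) (r : ℝ) (𝓕 : Finset ℕ → (ℕ → ℝ) → ℝ) : Prop where
  consecutive : ∀ p : ℕ → ℝ, (∀ j, p j ∈ Icc (0 : ℝ) 1) → ∀ j₁ j₂ : ℕ, j₁ ≤ j₂ →
    𝓕 (Finset.Icc j₁ j₂) p ≤ f (∑ j ∈ Finset.Icc j₁ j₂, p j)
  ignore_gap : ∀ p : ℕ → ℝ, (∀ j, p j ∈ Icc (0 : ℝ) 1) → ∀ (S₁ S₂ : Finset ℕ) (s : ℕ),
    Disjoint S₁ S₂ → (∀ j₁ ∈ S₁, ∀ j₂ ∈ S₂, j₁ < j₂) → (∀ j ∈ S₁, j < s) → (∀ j ∈ S₂, s < j) →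
    𝓕 (S₁ ∪ S₂) p ≤ max (1 - r * p s) 0 * 𝓕 (delSet S₁ S₂) (delSeq s p)
      + (1 - max (1 - r * p s) 0) * (𝓕 S₁ p * 𝓕 S₂ p)

/-- `A` is an `(f, r)`-continuous OCS: for every sequence of probability vectors, every element `i`
and every finite set `S` of time steps, the probability that `i` never wins during `S` is at most
`𝓕 S p`, with `p j` the probability of `i` at time `j` and `𝓕` as in `IsOCSBound`. -/
def ContinuousOCS.HasParameters {L : Type} [Fintype L] (A : ContinuousOCS L)
    (f : ℝ → ℝ) (r : ℝ) : Prop :=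
  ∃ 𝓕 : Finset ℕ → (ℕ → ℝ) → ℝ, IsOCSBound f r 𝓕 ∧
    ∀ (p : ℕ → stdSimplex ℝ L) (i : L) (S : Finset ℕ),
      A.μ.real {ω | ∀ j ∈ S, A.output p j ω ≠ i} ≤ 𝓕 S (fun j => (p j : L → ℝ) i)

/-! ### Edge-weighted online bipartite matching with free disposal -/

/-- The weight of the assignment `σ` of the `T` online vertices to the offline vertices `L`
(`none`: discarded) for the edge weights `w` (`0`: no edge). Every offline vertex counts with the
largest weight assigned to it, and with `0` if there is none. -/
def assignmentWeight {L : Type} [Fintype L] [DecidableEq L] {T : ℕ} (w : Fin T → L → ℝ≥0)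
    (σ : Fin T → Option L) : ℝ≥0 :=
  ∑ i, (Finset.univ.filter (fun j => σ j = some i)).sup (fun j => w j i)

/-- The optimal total weight with hindsight. -/
def offlineOpt {L : Type} [Fintype L] [DecidableEq L] {T : ℕ} (w : Fin T → L → ℝ≥0) : ℝ≥0 :=
  Finset.univ.sup (fun σ : Fin T → Option L => assignmentWeight w σ)

/-- An online matching algorithm for the offline vertices `L`: when an online vertex arrives, its
weights to all of `L` are revealed, and it is matched to an offline vertex or discarded. -/
abbrev OnlineMatchingAlgorithm (L : Type) : Type 1 :=
  OnlineAlgorithm (L → ℝ≥0) (Option L)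

/-- `B` is `Γ`-competitive: on every instance, the expected weight of its matching is at least `Γ`
times the optimum. -/
def OnlineMatchingAlgorithm.IsCompetitive {L : Type} [Fintype L] [DecidableEq L]
    (B : OnlineMatchingAlgorithm L) (Γ : ℝ) : Prop :=
  ∀ (T : ℕ) (w : Fin T → L → ℝ≥0),
    Γ * (offlineOpt w : ℝ) ≤ ∫ ω, (assignmentWeight w (B.outputs w ω) : ℝ) ∂B.μ

/-!
The matching algorithm runs a continuous OCS on `Option L`, where `none` means discarding, on
probability vectors produced by an online primal-dual method.

By the layer cake formula, the expected weight at an offline vertex is the integral over the weight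
levels `t > 0` of the probability that the vertex wins at a time step with weight at least `t`. The
complementary probability is bounded through the OCS rules (`IsOCSBound.le_stateMean`): the relevant
time steps form runs separated by gaps, each gap step is randomly ignored or cut, and the bound is
the expected product of `f` over the resulting runs. `stateMean` is this expectation, with an
arbitrary test function applied to the unfinished run, so that it is linear in the test function and
follows a simple recursion in time.

The dual variable of an offline vertex at level `t` is `Γ - E[P · G ℓ]`, where `P` is the product over
finished runs, `ℓ` the length of the unfinished run, and `G x = -∫ e⁻ˢ f' (x + s) ds`. This choice
makes the dual constraint tight below the weight of an edge, and `G' = G + f'` makes the primal and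
dual changes cancel. At levels above the weight the step is a gap, which raises the dual variable at
no primal gain; this is charged to the online vertex at rate `r · E[P · (G ℓ - Γ f ℓ)]`. The dual
constraint there reduces to `G + r (G - Γ f) ≤ Γ`, with equality at `0`; for log-concave `-f'` it
holds everywhere as soon as it holds to first order at `0`, and that is the condition on `r`
(`exists_isDualProfile`).

It remains to choose the probability vector for an arriving vertex so that its dual variable, the
average marginal value, dominates every marginal value. A maximizer of the sum of the antiderivatives
of the marginal values over the simplex does this (`exists_balanced`). Summation over time and
levels gives `IsDualProfile.dual_le_primal`, and weak duality `offlineOpt_le_of_dual` concludes. The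
OCS hypothesis for large ground sets is used once more, to see that `f 0 = 1`.
-/

/-! ### The dual profile -/

/-- If `u' ≤ u` then `e⁻ˣ u x` is nonincreasing; it tends to `0` when `u` is bounded, so `u ≥ 0`.
This is how comparisons between discounted tails `∫ e⁻ˢ u (x + s) ds` are obtained below without
manipulating the integrals. -/
theorem nonneg_of_deriv_le_self {u u' : ℝ → ℝ} {C : ℝ}
    (hu : ∀ x, 0 ≤ x → HasDerivWithinAt u (u' x) (Ici 0) x)
    (hle : ∀ x, 0 ≤ x → u' x ≤ u x) (hC : ∀ x, 0 ≤ x → |u x| ≤ C) {x : ℝ} (hx : 0 ≤ x) :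
    0 ≤ u x := by
  have hv : ∀ y, 0 ≤ y → HasDerivWithinAt (fun c => Real.exp (-c) * u c)
      (Real.exp (-y) * (u' y - u y)) (Ici 0) y := by
    intro y hy
    have h1 : HasDerivWithinAt (fun c : ℝ => Real.exp (-c)) (Real.exp (-y) * (-1)) (Ici 0) y :=
      ((hasDerivAt_neg y).exp).hasDerivWithinAt
    refine (h1.mul (hu y hy)).congr_deriv ?_
    ring
  have hanti : AntitoneOn (fun c => Real.exp (-c) * u c) (Ici 0) :=
    antitoneOn_of_hasDerivWithinAt_nonpos (convex_Ici 0)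
      (fun y hy => (hv y hy).continuousWithinAt)
      (fun y hy => (hv y (interior_subset hy)).mono interior_subset)
      (fun y hy => mul_nonpos_of_nonneg_of_nonpos (Real.exp_pos _).le
        (sub_nonpos.2 (hle y (interior_subset hy))))
  have hlim : Tendsto (fun c => Real.exp (-c) * u c) atTop (𝓝 0) := by
    have h0 : Tendsto (fun c : ℝ => Real.exp (-c) * C) atTop (𝓝 0) := by
      simpa using (Real.tendsto_exp_neg_atTop_nhds_zero).mul_const C
    refine squeeze_zero_norm' ?_ h0
    filter_upwards [eventually_ge_atTop 0] with c hc
    rw [norm_mul, Real.norm_eq_abs, Real.norm_eq_abs, abs_of_pos (Real.exp_pos _)]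
    exact mul_le_mul_of_nonneg_left (hC c hc) (Real.exp_pos _).le
  have h := le_of_tendsto hlim (by
    filter_upwards [eventually_ge_atTop x] with c hc
    exact hanti hx (hx.trans hc : (0 : ℝ) ≤ c) hc)
  exact nonneg_of_mul_nonneg_right h (Real.exp_pos _)

theorem HasDerivWithinAt.comp_const_add_Ici {u : ℝ → ℝ} {d a y : ℝ} (ha : 0 ≤ a)
    (h : HasDerivWithinAt u d (Ici 0) (a + y)) :
    HasDerivWithinAt (fun t => u (a + t)) d (Ici 0) y := by
  have h1 : HasDerivWithinAt (fun t : ℝ => a + t) 1 (Ici 0) y :=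
    ((hasDerivAt_id y).const_add a).hasDerivWithinAt
  exact (h.comp y h1 (fun t (ht : 0 ≤ t) => (add_nonneg ha ht : (0 : ℝ) ≤ a + t))).congr_deriv
    (mul_one d)

/-- If `u'/u` is nonincreasing, then so is `t ↦ u (a + x + t) / u (a + t)`; compare `t = 0` with
`t = s`. The hypothesis on `u'/u` is cleared of denominators since `u` may vanish from some point
on. -/
theorem mul_le_mul_of_logDeriv_antitone {u u' : ℝ → ℝ}
    (hu : ∀ x, 0 ≤ x → HasDerivWithinAt u (u' x) (Ici 0) x)
    (hnonneg : ∀ x, 0 ≤ x → 0 ≤ u x) (hanti : AntitoneOn u (Ici 0))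
    (hlog : ∀ a b, 0 ≤ a → a ≤ b → u' b * u a ≤ u' a * u b)
    {a x s : ℝ} (ha : 0 ≤ a) (hx : 0 ≤ x) (hs : 0 ≤ s) :
    u (a + x + s) * u a ≤ u (a + x) * u (a + s) := by
  have hax := add_nonneg ha hx
  rcases (hnonneg (a + x + s) (add_nonneg hax hs)).eq_or_lt with h0 | hpos
  · rw [← h0, zero_mul]
    exact mul_nonneg (hnonneg _ hax) (hnonneg _ (add_nonneg ha hs))
  have hpos' : ∀ t ∈ Icc 0 s, 0 < u (a + t) := fun t ht =>
    hpos.trans_le (hanti (add_nonneg ha ht.1 : (0 : ℝ) ≤ _) (add_nonneg hax hs : (0 : ℝ) ≤ _)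
      (by linarith [ht.2]))
  have hq : ∀ t ∈ Icc 0 s, HasDerivWithinAt (fun t => u (a + x + t) / u (a + t))
      ((u' (a + x + t) * u (a + t) - u (a + x + t) * u' (a + t)) / u (a + t) ^ 2) (Ici 0) t :=
    fun t ht => ((hu _ (add_nonneg hax ht.1)).comp_const_add_Ici hax).div
      ((hu _ (add_nonneg ha ht.1)).comp_const_add_Ici ha) (hpos' t ht).ne'
  have hmono : AntitoneOn (fun t => u (a + x + t) / u (a + t)) (Icc 0 s) :=
    antitoneOn_of_hasDerivWithinAt_nonpos (convex_Icc 0 s)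
      (fun t ht => ((hq t ht).mono Icc_subset_Ici_self).continuousWithinAt)
      (fun t ht => (hq t (interior_subset ht)).mono (interior_subset.trans Icc_subset_Ici_self))
      (fun t ht => by
        have ht' := interior_subset ht
        refine div_nonpos_of_nonpos_of_nonneg ?_ (sq_nonneg _)
        have := hlog (a + t) (a + x + t) (add_nonneg ha ht'.1) (by linarith)
        linarith)
  have h := hmono (left_mem_Icc.2 hs) (right_mem_Icc.2 hs) hs
  simp only [add_zero] at h
  rw [div_le_div_iff₀ (hpos' s ⟨hs, le_rfl⟩) (by simpa using hpos' 0 ⟨le_rfl, hs⟩)] at h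
  exact h

/-- What the analysis of the matching algorithm needs to know about `f` and about the function `G`
that prices a further infinitesimal selection after an uninterrupted run of total probability `x`.
For `f` as in the theorem, `G x = f x - ∫ e⁻ˢ f (x + s) ds = -∫ e⁻ˢ f' (x + s) ds`.

* `tangent_le`: `f - G` has derivative `-G` and is convex, here as the tangent line inequality;
* `mul_f_le`: replacing a run by a fresh start (which multiplies by `f x` and resets the run) does
  not increase the price;
* `gap_le`: the dual increase caused by a gap never has to exceed what is still owed. -/
structure IsDualProfile (f G : ℝ → ℝ) (Γ r : ℝ) : Prop where
  f_zero : f 0 = 1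
  f_mem : ∀ x, 0 ≤ x → f x ∈ Icc (0 : ℝ) 1
  G_zero : G 0 = Γ
  G_nonneg : ∀ x, 0 ≤ x → 0 ≤ G x
  G_antitone : AntitoneOn G (Ici 0)
  G_lipschitz : ∃ K, ∀ x y, 0 ≤ x → x ≤ y → G x - G y ≤ K * (y - x)
  tangent_le : ∀ x y, 0 ≤ x → 0 ≤ y → (y - x) * G y ≤ (f x - G x) - (f y - G y)
  mul_f_le : ∀ x, 0 ≤ x → Γ * f x ≤ G x
  gap_le : ∀ x, 0 ≤ x → G x + r * (G x - Γ * f x) ≤ Γ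

/-- The discounted tail `H x = ∫ e⁻ˢ f (x + s) ds`, characterized by `H' = H - f`, boundedness and
its value at `0`. -/
theorem exists_discounted_tail {f : ℝ → ℝ} (hf : ContinuousOn f (Ici 0))
    (hf_range : ∀ x, 0 ≤ x → f x ∈ Icc (0 : ℝ) 1) :
    ∃ H : ℝ → ℝ, H 0 = ∫ t in Ioi (0 : ℝ), Real.exp (-t) * f t ∧
      (∀ x, 0 ≤ x → HasDerivWithinAt H (H x - f x) (Ici 0) x) ∧
      ∀ x, 0 ≤ x → H x ∈ Icc (0 : ℝ) 1 := by
  -- `e` agrees with the integrand on `[0, ∞)` and is continuous on the whole line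
  set e : ℝ → ℝ := fun t => Real.exp (-t) * f (max t 0) with he
  have hec : Continuous e := by
    have : Continuous fun t : ℝ => f (max t 0) :=
      hf.comp_continuous (by fun_prop) (fun t => le_max_right t 0)
    exact (Real.continuous_exp.comp continuous_neg).mul this
  have hm : ∀ t, f (max t 0) ∈ Icc (0 : ℝ) 1 := fun t => hf_range _ (le_max_right t 0)
  have he0 : ∀ t, 0 ≤ e t := fun t => mul_nonneg (Real.exp_pos _).le (hm t).1
  have he1 : ∀ t, e t ≤ Real.exp (-t) := fun t =>
    mul_le_of_le_one_right (Real.exp_pos _).le (hm t).2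
  have hexp : ∀ x : ℝ, IntegrableOn (fun t => Real.exp (-t)) (Ioi x) := fun x => by
    simpa using exp_neg_integrableOn_Ioi x one_pos
  have hint : ∀ x : ℝ, IntegrableOn e (Ioi x) := fun x =>
    (hexp x).mono' hec.aestronglyMeasurable (ae_of_all _ fun t => by
      rw [Real.norm_eq_abs, abs_of_nonneg (he0 t)]; exact he1 t)
  have hsplit : ∀ x, ∫ t in Ioi x, e t = (∫ t in Ioi (0 : ℝ), e t) - ∫ t in (0 : ℝ)..x, e t := by
    intro x
    have := intervalIntegral.integral_Ioi_sub_Ioi' (hint 0) (hint x)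
    linarith
  refine ⟨fun x => Real.exp x * ∫ t in Ioi x, e t, ?_, ?_, ?_⟩
  · simp only [Real.exp_zero, one_mul]
    refine setIntegral_congr_fun measurableSet_Ioi fun t ht => ?_
    simp [he, max_eq_left (le_of_lt (show (0 : ℝ) < t from ht))]
  · intro x hx
    have h1 : HasDerivAt (fun x => ∫ t in Ioi x, e t) (-e x) x := by
      rw [funext hsplit]
      simpa only [zero_sub] using (intervalIntegral.integral_hasDerivAt_right (hec.intervalIntegrable _ _)
        hec.stronglyMeasurable.stronglyMeasurableAtFilter hec.continuousAt).const_sub _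
    refine ((Real.hasDerivAt_exp x).mul h1).hasDerivWithinAt.congr_deriv ?_
    have : Real.exp x * Real.exp (-x) = 1 := by rw [← Real.exp_add]; simp
    simp only [he, max_eq_left hx]
    linear_combination (-f x) * this
  · intro x hx
    refine ⟨mul_nonneg (Real.exp_pos _).le (setIntegral_nonneg measurableSet_Ioi fun t _ => he0 t), ?_⟩
    have h2 : ∫ t in Ioi x, e t ≤ Real.exp (-x) := by
      rw [← integral_exp_neg_Ioi]
      exact setIntegral_mono (hint x) (hexp x) he1
    calc Real.exp x * ∫ t in Ioi x, e t ≤ Real.exp x * Real.exp (-x) :=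
          mul_le_mul_of_nonneg_left h2 (Real.exp_pos _).le
      _ = 1 := by rw [← Real.exp_add]; simp

/-- With `g = -f'` and `G = f - H`, where `H` is the discounted tail of `f`, one has
`G' = G - g` and `G 0 = Γ`. Log-concavity of `g` gives `g 0 * G x ≤ Γ * g x` and the log-concavity
of `f`; together with the bound on `r`, the first of these makes the left side of `gap_le`
nonincreasing in `x`, with value `Γ` at `0`. -/
theorem exists_isDualProfile
    (f f' f'' f''' : ℝ → ℝ)
    (hf_range : ∀ x, 0 ≤ x → f x ∈ Icc (0 : ℝ) 1)
    (hf' : ∀ x, 0 ≤ x → HasDerivWithinAt f (f' x) (Ici 0) x)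
    (hf'' : ∀ x, 0 ≤ x → HasDerivWithinAt f' (f'' x) (Ici 0) x)
    (hf''' : ∀ x, 0 ≤ x → HasDerivWithinAt f'' (f''' x) (Ici 0) x)
    (hf_convex : ConvexOn ℝ (Ici 0) f)
    (hf_logconcave : ∀ x, 0 ≤ x → f''' x * f' x ≤ f'' x ^ 2)
    (hf_lim : Tendsto f atTop (𝓝 0)) (hf_zero : f 0 = 1)
    (Γ : ℝ) (hΓ : Γ = 1 - ∫ t in Ioi (0 : ℝ), Real.exp (-t) * f t)
    (r : ℝ) (hr_nonneg : 0 ≤ r)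
    (hr : Γ + (1 - Γ) * f' 0 ≠ 0 → r ≤ (-f' 0 - Γ) / (Γ + (1 - Γ) * f' 0)) :
    ∃ G, IsDualProfile f G Γ r := by
  have hslope : ∀ x y, 0 ≤ x → x < y → f' x * (y - x) ≤ f y - f x ∧
      f y - f x ≤ f' y * (y - x) := by
    intro x y hx hxy
    have hy := hx.trans hxy.le
    have hyx : 0 < y - x := sub_pos.2 hxy
    constructor
    · have := hf_convex.le_slope_of_hasDerivWithinAt hx hy hxy (hf' x hx)
      rwa [slope_def_field, le_div_iff₀ hyx] at this
    · have := hf_convex.slope_le_of_hasDerivWithinAt hx hy hxy (hf' y hy)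
      rwa [slope_def_field, div_le_iff₀ hyx] at this
  set g : ℝ → ℝ := fun x => -f' x with hg
  have hg_deriv : ∀ x, 0 ≤ x → HasDerivWithinAt g (-f'' x) (Ici 0) x := fun x hx => (hf'' x hx).neg
  have hg_anti : AntitoneOn g (Ici 0) := by
    intro x hx y hy hxy
    rcases hxy.eq_or_lt with rfl | hlt
    · exact le_rfl
    have := hslope x y hx hlt
    have : f' x ≤ f' y := le_of_mul_le_mul_right (this.1.trans this.2) (sub_pos.2 hlt)
    simpa [hg] using this
  have hg_nonneg : ∀ x, 0 ≤ x → 0 ≤ g x := by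
    intro x hx
    by_contra! hneg
    have hpos : 0 < f' x := by simpa [hg] using hneg
    -- a slope `f' x > 0` would lift `f` by at least `2` within distance `2 / f' x`
    have h1 := (hslope x (x + 2 / f' x) hx (by simp; positivity)).1
    have h2 := (hf_range x hx).1
    have h3 := (hf_range (x + 2 / f' x) (by positivity)).2
    have h4 : f' x * (x + 2 / f' x - x) = 2 := by field_simp; ring
    linarith
  have hf_anti : AntitoneOn f (Ici 0) := by
    intro x hx y hy hxy
    rcases hxy.eq_or_lt with rfl | hlt
    · exact le_rfl
    have h1 := (hslope x y hx hlt).2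
    have h2 := mul_nonneg (hg_nonneg y hy) (sub_pos.2 hlt).le
    simp only [hg] at h2
    linarith
  have hf''_nonneg : ∀ x, 0 ≤ x → 0 ≤ f'' x := by
    intro x hx
    refine (hf'' x hx).nonneg_of_monotoneOn ?_ ?_
    · have : (𝓝[>] x).NeBot := inferInstance
      rw [accPt_principal_iff_nhdsWithin]
      exact this.mono (nhdsWithin_mono _ fun y (hy : x < y) => ⟨hx.trans hy.le, hy.ne'⟩)
    · intro a ha b hb hab
      have := hg_anti ha hb hab
      simpa [hg] using this
  have hg_log : ∀ a b, 0 ≤ a → a ≤ b → -f'' b * g a ≤ -f'' a * g b := by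
    intro a b ha hab
    have hb := ha.trans hab
    rcases (hg_nonneg b hb).eq_or_lt with h0 | hpos
    · rw [← h0, mul_zero, neg_mul]
      exact neg_nonpos.2 (mul_nonneg (hf''_nonneg b hb) (hg_nonneg a ha))
    have hpos' : ∀ t ∈ Icc a b, 0 < g t := fun t ht =>
      hpos.trans_le (hg_anti (ha.trans ht.1 : (0 : ℝ) ≤ t) hb ht.2)
    have hsub : Icc a b ⊆ Ici 0 := fun t ht => ha.trans ht.1
    have hq : ∀ t ∈ Icc a b, HasDerivWithinAt (fun t => f'' t / g t)
        ((f''' t * g t - f'' t * -f'' t) / g t ^ 2) (Ici 0) t := fun t ht =>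
      (hf''' t (hsub ht)).div (hg_deriv t (hsub ht)) (hpos' t ht).ne'
    have hmono : MonotoneOn (fun t => f'' t / g t) (Icc a b) :=
      monotoneOn_of_hasDerivWithinAt_nonneg (convex_Icc a b)
        (fun t ht => ((hq t ht).mono hsub).continuousWithinAt)
        (fun t ht => (hq t (interior_subset ht)).mono (interior_subset.trans hsub))
        (fun t ht => by
          refine div_nonneg ?_ (sq_nonneg _)
          have := hf_logconcave t (hsub (interior_subset ht))
          simp only [hg]
          nlinarith)
    have h := hmono (left_mem_Icc.2 hab) (right_mem_Icc.2 hab) hab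
    rw [div_le_div_iff₀ (hpos' a ⟨le_rfl, hab⟩) hpos] at h
    linarith
  -- log-concavity of `g`, without logarithms
  have hg_mul : ∀ a x s, 0 ≤ a → 0 ≤ x → 0 ≤ s →
      g (a + x + s) * g a ≤ g (a + x) * g (a + s) := fun a x s ha hx hs =>
    mul_le_mul_of_logDeriv_antitone hg_deriv hg_nonneg hg_anti hg_log ha hx hs
  have hf_deriv : ∀ x, 0 ≤ x → HasDerivWithinAt f (-g x) (Ici 0) x := by simpa [hg] using hf'
  -- the hazard rate `g / f` is nondecreasing
  have hhazard : ∀ a b, 0 ≤ a → a ≤ b → g a * f b ≤ g b * f a := by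
    intro a b ha hab
    have hb := ha.trans hab
    have hq : ∀ t, 0 ≤ t → HasDerivWithinAt (fun t => g b * f (a + t) - g a * f (b + t))
        (g b * -g (a + t) - g a * -g (b + t)) (Ici 0) t := fun t ht =>
      (((hf_deriv _ (add_nonneg ha ht)).comp_const_add_Ici ha).const_mul _).sub
        (((hf_deriv _ (add_nonneg hb ht)).comp_const_add_Ici hb).const_mul _)
    have hanti : AntitoneOn (fun t => g b * f (a + t) - g a * f (b + t)) (Ici 0) :=
      antitoneOn_of_hasDerivWithinAt_nonpos (convex_Ici 0)
        (fun t ht => (hq t ht).continuousWithinAt)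
        (fun t ht => (hq t (interior_subset ht)).mono interior_subset)
        (fun t ht => by
          have := hg_mul a (b - a) t ha (sub_nonneg.2 hab) (interior_subset ht)
          rw [add_sub_cancel] at this
          linarith)
    have hshift : ∀ c, Tendsto (fun t => f (c + t)) atTop (𝓝 0) := fun c =>
      hf_lim.comp (tendsto_atTop_add_const_left _ c tendsto_id)
    have hlim : Tendsto (fun t => g b * f (a + t) - g a * f (b + t)) atTop (𝓝 0) := by
      simpa using ((hshift a).const_mul (g b)).sub ((hshift b).const_mul (g a))
    have h := le_of_tendsto hlim (by
      filter_upwards [eventually_ge_atTop 0] with t ht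
      exact hanti (self_mem_Ici) ht ht)
    simp only [add_zero] at h
    linarith
  have hf_mul : ∀ x s, 0 ≤ x → 0 ≤ s → f (x + s) ≤ f x * f s := by
    intro x s hx hs
    have := mul_le_mul_of_logDeriv_antitone hf_deriv (fun x hx => (hf_range x hx).1) hf_anti
      (fun a b ha hab => by linarith [hhazard a b ha hab]) le_rfl hx hs
    simpa [hf_zero] using this
  obtain ⟨H, hH0, hH', hHm⟩ := exists_discounted_tail
    (fun x hx => (hf' x hx).continuousWithinAt) hf_range
  rw [← hH0] at hΓ
  set G : ℝ → ℝ := fun x => f x - H x with hGdef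
  have hG0 : G 0 = Γ := by simp [hGdef, hf_zero, hΓ]
  have hG' : ∀ x, 0 ≤ x → HasDerivWithinAt G (G x - g x) (Ici 0) x := fun x hx => by
    refine ((hf' x hx).sub (hH' x hx)).congr_deriv ?_
    simp only [hGdef, hg]; ring
  have hGb : ∀ x, 0 ≤ x → |G x| ≤ 1 := fun x hx => by
    have h1 := hf_range x hx
    have h2 := hHm x hx
    rw [abs_le]; constructor <;> simp only [hGdef] <;> linarith [h1.1, h1.2, h2.1, h2.2]
  have hG_nonneg : ∀ x, 0 ≤ x → 0 ≤ G x := fun x hx =>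
    nonneg_of_deriv_le_self hG' (fun y hy => by linarith [hg_nonneg y hy]) hGb hx
  have hG_le_one : ∀ x, 0 ≤ x → G x ≤ 1 := fun x hx => (abs_le.1 (hGb x hx)).2
  have hG_le_g : ∀ x, 0 ≤ x → G x ≤ g x := by
    intro x hx
    have h := nonneg_of_deriv_le_self (u := fun c => g x - G (x + c)) (C := g x + 1)
      (fun c hc => ((hG' _ (add_nonneg hx hc)).comp_const_add_Ici hx).const_sub (g x))
      (fun c hc => by
        have := hg_anti hx (add_nonneg hx hc : (0 : ℝ) ≤ x + c) (by linarith)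
        linarith)
      (fun c hc => (abs_sub _ _).trans (add_le_add (abs_of_nonneg (hg_nonneg x hx)).le
        (hGb _ (add_nonneg hx hc)))) le_rfl
    simpa using h
  have hG_ratio : ∀ x, 0 ≤ x → g 0 * G x ≤ Γ * g x := by
    intro x hx
    have h := nonneg_of_deriv_le_self (u := fun c => g x * G c - g 0 * G (x + c))
      (C := g x + g 0)
      (fun c hc => ((hG' c hc).const_mul _).sub
        (((hG' _ (add_nonneg hx hc)).comp_const_add_Ici hx).const_mul _))
      (fun c hc => by
        have := hg_mul 0 x c le_rfl hx hc
        simp only [zero_add] at this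
        linarith)
      (fun c hc => by
        have h1 := hg_nonneg x hx
        have h2 := hg_nonneg 0 le_rfl
        have h3 := hG_nonneg c hc
        have h4 := hG_nonneg _ (add_nonneg hx hc)
        have h5 := mul_le_of_le_one_right h1 (hG_le_one c hc)
        have h6 := mul_le_of_le_one_right h2 (hG_le_one _ (add_nonneg hx hc))
        have h7 := mul_nonneg h1 h3
        have h8 := mul_nonneg h2 h4
        rw [abs_le]; constructor <;> linarith) le_rfl
    simp only [add_zero, hG0] at h
    linarith
  have hf_le_G : ∀ x, 0 ≤ x → Γ * f x ≤ G x := by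
    intro x hx
    have h := nonneg_of_deriv_le_self (u := fun c => f x * H c - H (x + c)) (C := 1)
      (fun c hc => ((hH' c hc).const_mul _).sub
        ((hH' _ (add_nonneg hx hc)).comp_const_add_Ici hx))
      (fun c hc => by
        have := hf_mul x c hx hc
        linarith)
      (fun c hc => by
        have h1 := hf_range x hx
        have h2 := hHm c hc
        have h3 := hHm _ (add_nonneg hx hc)
        have h4 := mul_le_one₀ h1.2 h2.1 h2.2
        have h5 := mul_nonneg h1.1 h2.1
        rw [abs_le]; constructor <;> linarith [h3.1, h3.2]) le_rfl
    simp only [add_zero] at h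
    simp only [hGdef, hΓ]
    linarith
  -- the denominator in the bound on `r` is nonnegative
  have hden : g 0 * (1 - Γ) ≤ Γ := by
    have h := nonneg_of_deriv_le_self (u := fun c => G c - g 0 * H c) (C := 1 + g 0)
      (fun c hc => (hG' c hc).sub ((hH' c hc).const_mul _))
      (fun c hc => by
        have := hhazard 0 c le_rfl hc
        rw [hf_zero] at this
        linarith)
      (fun c hc => (abs_sub _ _).trans (add_le_add (hGb c hc) (by
        rw [abs_of_nonneg (mul_nonneg (hg_nonneg 0 le_rfl) (hHm c hc).1)]
        exact mul_le_of_le_one_right (hg_nonneg 0 le_rfl) (hHm c hc).2))) le_rfl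
    have hH1 : H 0 = 1 - Γ := by rw [hΓ]; ring
    simp only [hG0, hH1] at h
    linarith
  have hg0_pos : 0 < g 0 := by
    by_contra! hle
    -- otherwise `f` would stay constantly equal to `1`
    have hconst : ∀ y, 0 ≤ y → 1 ≤ f y := by
      intro y hy
      rcases hy.eq_or_lt with rfl | hlt
      · exact hf_zero.ge
      have h1 := (hslope 0 y le_rfl hlt).1
      have h2 : 0 ≤ f' 0 := by simpa [hg] using hle
      have := mul_nonneg h2 (sub_pos.2 hlt).le
      linarith
    have := ge_of_tendsto hf_lim (by
      filter_upwards [eventually_ge_atTop 0] with y hy using hconst y hy)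
    linarith
  have hcond : (1 + r) * Γ ≤ (1 + r - r * Γ) * g 0 := by
    have hd : Γ + (1 - Γ) * f' 0 = Γ - g 0 * (1 - Γ) := by simp [hg]; ring
    have hn : -f' 0 - Γ = g 0 - Γ := rfl
    rw [hd, hn] at hr
    have key : r * (Γ - g 0 * (1 - Γ)) ≤ g 0 - Γ := by
      rcases (sub_nonneg.2 hden).eq_or_lt with h0 | hpos
      · -- here `r` is unconstrained, and the inequality holds because `G ≤ g`
        rw [← h0, mul_zero]
        have := hG_le_g 0 le_rfl
        rw [hG0] at this
        linarith
      · exact (le_div_iff₀ hpos).1 (hr hpos.ne')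
    linarith
  have hgap : ∀ x, 0 ≤ x → G x + r * (G x - Γ * f x) ≤ Γ := by
    have hM : ∀ x, 0 ≤ x → HasDerivWithinAt (fun x => G x + r * (G x - Γ * f x))
        ((G x - g x) + r * ((G x - g x) - Γ * -g x)) (Ici 0) x := fun x hx =>
      (hG' x hx).add (((hG' x hx).sub ((hf_deriv x hx).const_mul Γ)).const_mul r)
    have hanti : AntitoneOn (fun x => G x + r * (G x - Γ * f x)) (Ici 0) :=
      antitoneOn_of_hasDerivWithinAt_nonpos (convex_Ici 0)
        (fun t ht => (hM t ht).continuousWithinAt)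
        (fun t ht => (hM t (interior_subset ht)).mono interior_subset)
        (fun t ht => by
          have ht' : 0 ≤ t := interior_subset ht
          have h1 := mul_le_mul_of_nonneg_left (hG_ratio t ht') (add_nonneg zero_le_one hr_nonneg)
          have h2 := mul_le_mul_of_nonneg_right hcond (hg_nonneg t ht')
          have h3 : g 0 * ((1 + r) * G t) ≤ g 0 * ((1 + r - r * Γ) * g t) := by linarith
          have h4 := le_of_mul_le_mul_left h3 hg0_pos
          linarith)
    intro x hx
    have h := hanti self_mem_Ici hx hx
    simp only [hG0, hf_zero] at h
    linarith
  have hG_anti : AntitoneOn G (Ici 0) :=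
    antitoneOn_of_hasDerivWithinAt_nonpos (convex_Ici 0)
      (fun t ht => (hG' t ht).continuousWithinAt)
      (fun t ht => (hG' t (interior_subset ht)).mono interior_subset)
      (fun t ht => sub_nonpos.2 (hG_le_g t (interior_subset ht)))
  have hH_eq : ∀ x, f x - G x = H x := fun x => by simp [hGdef]
  have hmvt : ∀ x y, 0 ≤ x → x < y → ∃ c ∈ Ioo x y, H x - H y = G c * (y - x) := by
    intro x y hx hxy
    obtain ⟨c, hc, h⟩ := exists_hasDerivAt_eq_slope H (fun c => H c - f c) hxy
      (fun t ht => ((hH' t (hx.trans ht.1)).mono fun s hs => hx.trans hs.1).continuousWithinAt)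
      (fun t ht => (hH' t (hx.trans ht.1.le)).hasDerivAt (Ici_mem_nhds (hx.trans_lt ht.1)))
    refine ⟨c, hc, ?_⟩
    rw [eq_div_iff (sub_pos.2 hxy).ne'] at h
    simp only [hGdef]
    linarith
  refine ⟨G, hf_zero, hf_range, hG0, hG_nonneg, hG_anti, ⟨g 0, ?_⟩, ?_, hf_le_G, hgap⟩
  · intro x y hx hxy
    have hN : ∀ x, 0 ≤ x → HasDerivWithinAt (fun x => G x + g 0 * x)
        ((G x - g x) + g 0 * 1) (Ici 0) x := fun x hx =>
      (hG' x hx).add ((hasDerivWithinAt_id x _).const_mul (g 0))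
    have hmono : MonotoneOn (fun x => G x + g 0 * x) (Ici 0) :=
      monotoneOn_of_hasDerivWithinAt_nonneg (convex_Ici 0)
        (fun t ht => (hN t ht).continuousWithinAt)
        (fun t ht => (hN t (interior_subset ht)).mono interior_subset)
        (fun t ht => by
          have ht' : (0 : ℝ) ≤ t := interior_subset ht
          have h1 := hG_nonneg t ht'
          have h2 := hg_anti self_mem_Ici ht' ht'
          linarith)
    have := hmono hx (hx.trans hxy : (0 : ℝ) ≤ y) hxy
    simp only at this
    linarith
  · intro x y hx hy
    rw [hH_eq, hH_eq]
    rcases lt_trichotomy x y with h | rfl | h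
    · obtain ⟨c, hc, he⟩ := hmvt x y hx h
      rw [he, mul_comm]
      exact mul_le_mul_of_nonneg_right
        (hG_anti (hx.trans hc.1.le : (0 : ℝ) ≤ c) hy hc.2.le) (sub_pos.2 h).le
    · simp
    · obtain ⟨c, hc, he⟩ := hmvt y x hy h
      have := mul_le_mul_of_nonneg_right
        (hG_anti hy (hy.trans hc.1.le : (0 : ℝ) ≤ c) hc.1.le) (sub_pos.2 h).le
      linarith

/-! ### From the OCS rules to a recursive bound -/

open Classical in
/-- The gaps of `S` cut it into runs. Let a gap step of probability `x` be ignored with probability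
`max (1 - r * x) 0` and cut otherwise, and let every completed run of total probability `y`
contribute a factor `f y`. Then `stateMean f r p S n h` is the expectation, after the time steps
`0, …, n - 1`, of the product of these factors times `h` of the total probability of the current
run. In particular `stateMean f r p S n f` is the resulting bound on the probability of never
winning during `S`.

A cut closes the current run, also an empty one; this is harmless when `f 0 = 1`. -/
noncomputable def stateMean (f : ℝ → ℝ) (r : ℝ) (p : ℕ → ℝ) (S : Set ℕ) : ℕ → (ℝ → ℝ) → ℝ
  | 0, h => h 0
  | n + 1, h =>
    if n ∈ S then stateMean f r p S n (fun y => h (y + p n))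
    else max (1 - r * p n) 0 * stateMean f r p S n h
      + (1 - max (1 - r * p n) 0) * (stateMean f r p S n f * h 0)

section StateMean

variable {f : ℝ → ℝ} {r : ℝ} {p q : ℕ → ℝ} {S S' : Set ℕ} {n : ℕ}

theorem stateMean_succ_of_mem (hn : n ∈ S) (h : ℝ → ℝ) :
    stateMean f r p S (n + 1) h = stateMean f r p S n (fun y => h (y + p n)) := by
  rw [stateMean, if_pos hn]

theorem stateMean_succ_of_notMem (hn : n ∉ S) (h : ℝ → ℝ) :
    stateMean f r p S (n + 1) h = max (1 - r * p n) 0 * stateMean f r p S n h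
      + (1 - max (1 - r * p n) 0) * (stateMean f r p S n f * h 0) := by
  rw [stateMean, if_neg hn]

theorem stateMean_congr (hp : ∀ k < n, p k = q k) (hS : ∀ k < n, k ∈ S ↔ k ∈ S') (h : ℝ → ℝ) :
    stateMean f r p S n h = stateMean f r q S' n h := by
  induction n generalizing h with
  | zero => rfl
  | succ n ih =>
    have ih' := ih (fun k hk => hp k (by omega)) (fun k hk => hS k (by omega))
    by_cases hn : n ∈ S
    · rw [stateMean_succ_of_mem hn, stateMean_succ_of_mem ((hS n (by omega)).1 hn), ih',
        hp n (by omega)]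
    · rw [stateMean_succ_of_notMem hn, stateMean_succ_of_notMem (mt (hS n (by omega)).2 hn), ih',
        ih', hp n (by omega)]

theorem stateMean_eq_apply_zero (hf0 : f 0 = 1) (hS : ∀ k < n, k ∉ S) (h : ℝ → ℝ) :
    stateMean f r p S n h = h 0 := by
  induction n generalizing h with
  | zero => rfl
  | succ n ih =>
    have ih' := ih (fun k hk => hS k (by omega))
    rw [stateMean_succ_of_notMem (hS n (by omega)), ih', ih', hf0]
    ring

theorem stateMean_succ_self_of_notMem (hf0 : f 0 = 1) (hn : n ∉ S) :
    stateMean f r p S (n + 1) f = stateMean f r p S n f := by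
  rw [stateMean_succ_of_notMem hn, hf0]
  ring

theorem stateMean_sub (h₁ h₂ : ℝ → ℝ) :
    stateMean f r p S n (fun y => h₁ y - h₂ y) = stateMean f r p S n h₁ - stateMean f r p S n h₂ := by
  induction n generalizing h₁ h₂ with
  | zero => rfl
  | succ n ih =>
    by_cases hn : n ∈ S
    · simp only [stateMean_succ_of_mem hn, ih]
    · simp only [stateMean_succ_of_notMem hn, ih]
      ring

theorem stateMean_const_mul (c : ℝ) (h : ℝ → ℝ) :
    stateMean f r p S n (fun y => c * h y) = c * stateMean f r p S n h := by
  induction n generalizing h with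
  | zero => rfl
  | succ n ih =>
    by_cases hn : n ∈ S
    · simp only [stateMean_succ_of_mem hn, ih]
    · simp only [stateMean_succ_of_notMem hn, ih]
      ring

theorem gapWeight_mem {x : ℝ} (hr : 0 ≤ r) (hx : 0 ≤ x) :
    max (1 - r * x) 0 ∈ Icc (0 : ℝ) 1 :=
  ⟨le_max_right _ _, max_le (by linarith [mul_nonneg hr hx]) zero_le_one⟩

theorem stateMean_nonneg (hr : 0 ≤ r) (hp : ∀ j, 0 ≤ p j) (hf : ∀ x, 0 ≤ x → 0 ≤ f x)
    {h : ℝ → ℝ} (hh : ∀ x, 0 ≤ x → 0 ≤ h x) : 0 ≤ stateMean f r p S n h := by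
  induction n generalizing h with
  | zero => exact hh 0 le_rfl
  | succ n ih =>
    by_cases hn : n ∈ S
    · rw [stateMean_succ_of_mem hn]
      exact ih fun x hx => hh _ (add_nonneg hx (hp n))
    · rw [stateMean_succ_of_notMem hn]
      have hw := gapWeight_mem hr (hp n)
      exact add_nonneg (mul_nonneg hw.1 (ih hh))
        (mul_nonneg (sub_nonneg.2 hw.2) (mul_nonneg (ih hf) (hh 0 le_rfl)))

theorem stateMean_mono (hr : 0 ≤ r) (hp : ∀ j, 0 ≤ p j) (hf : ∀ x, 0 ≤ x → 0 ≤ f x)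
    {h₁ h₂ : ℝ → ℝ} (hh : ∀ x, 0 ≤ x → h₁ x ≤ h₂ x) :
    stateMean f r p S n h₁ ≤ stateMean f r p S n h₂ := by
  have := stateMean_nonneg (S := S) (n := n) hr hp hf (h := fun y => h₂ y - h₁ y)
    fun x hx => sub_nonneg.2 (hh x hx)
  rw [stateMean_sub] at this
  exact sub_nonneg.1 this

theorem stateMean_le (hr : 0 ≤ r) (hp : ∀ j, 0 ≤ p j) (hf : ∀ x, 0 ≤ x → f x ∈ Icc (0 : ℝ) 1)
    {h : ℝ → ℝ} {C : ℝ} (hC : 0 ≤ C) (hh : ∀ x, 0 ≤ x → h x ≤ C) :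
    stateMean f r p S n h ≤ C := by
  have key : stateMean f r p S n (fun _ => 1) ≤ 1 := by
    induction n with
    | zero => exact le_rfl
    | succ n ih =>
      by_cases hn : n ∈ S
      · rw [stateMean_succ_of_mem hn]
        exact ih
      · rw [stateMean_succ_of_notMem hn]
        have hw := gapWeight_mem hr (hp n)
        have h1 : stateMean f r p S n f ≤ 1 :=
          (stateMean_mono hr hp (fun x hx => (hf x hx).1) fun x hx => (hf x hx).2).trans ih
        nlinarith [hw.1, hw.2]
  calc stateMean f r p S n h ≤ stateMean f r p S n (fun _ => C * 1) :=
        stateMean_mono hr hp (fun x hx => (hf x hx).1) (by simpa using hh)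
    _ = C * stateMean f r p S n (fun _ => 1) := stateMean_const_mul C (fun _ => 1)
    _ ≤ C := mul_le_of_le_one_right hC key

theorem measurable_stateMean {v : ℕ → ℝ} (h : ℝ → ℝ) :
    Measurable fun t : ℝ => stateMean f r p {j | t ≤ v j} n h := by
  induction n generalizing h with
  | zero => exact measurable_const
  | succ n ih =>
    simp only [stateMean]
    refine Measurable.ite ?_ (ih _) (((ih _).const_mul _).add (((ih _).mul_const _).const_mul _))
    exact measurableSet_Iic

end StateMean

/-- The two rules of `IsOCSBound` imply the bound `stateMean … f`. For the induction, a block of `m`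
consecutive time steps after the first `n` is split off: step `n - 1` is either absorbed into the
block, or it is a gap directly in front of the block, to which `ignore_gap` applies. No rule bounds
`𝓕 ∅`, which is why the empty set is excluded. -/
theorem IsOCSBound.le_stateMean {f : ℝ → ℝ} {r : ℝ} {𝓕 : Finset ℕ → (ℕ → ℝ) → ℝ}
    (h𝓕 : IsOCSBound f r 𝓕) (hr : 0 ≤ r) (hf : ∀ x, 0 ≤ x → f x ∈ Icc (0 : ℝ) 1) (hf0 : f 0 = 1)
    (h𝓕_nonneg : ∀ S p, (∀ j, p j ∈ Icc (0 : ℝ) 1) → 0 ≤ 𝓕 S p)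
    (n m : ℕ) (S : Finset ℕ) (hS : ∀ j ∈ S, j < n) (hne : S.Nonempty ∨ 0 < m)
    (p : ℕ → ℝ) (hp : ∀ j, p j ∈ Icc (0 : ℝ) 1) :
    𝓕 (S ∪ Finset.Ico n (n + m)) p ≤
      stateMean f r p S n (fun y => f (y + ∑ j ∈ Finset.Ico n (n + m), p j)) := by
  have hblock : ∀ (a b : ℕ), a < b → ∀ q : ℕ → ℝ, (∀ j, q j ∈ Icc (0 : ℝ) 1) →
      𝓕 (Finset.Ico a b) q ≤ f (∑ j ∈ Finset.Ico a b, q j) := by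
    intro a b hab q hq
    have : Finset.Ico a b = Finset.Icc a (b - 1) := by ext; simp; omega
    rw [this]
    exact h𝓕.consecutive q hq _ _ (by omega)
  induction n generalizing m S p with
  | zero =>
    have hS0 : S = ∅ := Finset.eq_empty_of_forall_notMem fun j hj => absurd (hS j hj) (by omega)
    subst hS0
    have hm : 0 < m := by simpa using hne
    simpa [stateMean] using hblock 0 (0 + m) (by omega) p hp
  | succ n ih =>
    by_cases hn : n ∈ S
    · have hset : S ∪ Finset.Ico (n + 1) (n + 1 + m) =
          S.erase n ∪ Finset.Ico n (n + (m + 1)) := by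
        ext j
        simp only [Finset.mem_union, Finset.mem_Ico, Finset.mem_erase]
        constructor
        · rintro (h | h)
          · by_cases hj : j = n
            · right; omega
            · exact Or.inl ⟨hj, h⟩
          · right; omega
        · rintro (h | h)
          · exact Or.inl h.2
          · by_cases hj : j = n
            · exact Or.inl (hj ▸ hn)
            · right; omega
      have h := ih (m + 1) (S.erase n)
        (fun j hj => lt_of_le_of_ne (Nat.lt_succ_iff.1 (hS j (Finset.mem_of_mem_erase hj)))
          (Finset.ne_of_mem_erase hj)) (Or.inr (by omega)) p hp
      rw [hset, stateMean_succ_of_mem (by exact_mod_cast hn)]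
      refine h.trans_eq ?_
      rw [Finset.sum_eq_sum_Ico_succ_bot (by omega : n < n + (m + 1)),
        show n + (m + 1) = n + 1 + m by omega]
      simp only [add_assoc]
      refine stateMean_congr (fun _ _ => rfl) (fun k hk => ?_) _
      simp [hk.ne]
    · have hSn : ∀ j ∈ S, j < n := fun j hj =>
        lt_of_le_of_ne (Nat.lt_succ_iff.1 (hS j hj)) fun h => hn (h ▸ hj)
      have hn' : n ∉ (S : Set ℕ) := by exact_mod_cast hn
      rcases Nat.eq_zero_or_pos m with rfl | hm
      · have h := ih 0 S hSn (by simpa using hne) p hp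
        simp only [add_zero, Finset.Ico_self, Finset.sum_empty, Finset.union_empty] at h ⊢
        exact h.trans_eq (stateMean_succ_self_of_notMem hf0 hn').symm
      rcases S.eq_empty_or_nonempty with rfl | hSne
      · rw [Finset.empty_union, stateMean_eq_apply_zero hf0 (by simp), zero_add]
        exact hblock _ _ (by omega) p hp
      rw [stateMean_succ_of_notMem hn', zero_add]
      have hgap := h𝓕.ignore_gap p hp S (Finset.Ico (n + 1) (n + 1 + m)) n
        (Finset.disjoint_left.2 fun j hj hj' => by
          have := hSn j hj; have := (Finset.mem_Ico.1 hj').1; omega)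
        (fun j hj j' hj' => by
          have := hSn j hj; have := (Finset.mem_Ico.1 hj').1; omega)
        hSn (fun j hj => (Finset.mem_Ico.1 hj).1)
      have hdel : delSet S (Finset.Ico (n + 1) (n + 1 + m)) = S ∪ Finset.Ico n (n + m) := by
        rw [delSet]
        congr 1
        ext j
        simp only [Finset.mem_image, Finset.mem_Ico]
        constructor
        · rintro ⟨k, hk, rfl⟩; omega
        · intro hj; exact ⟨j + 1, by omega, by omega⟩
      rw [hdel] at hgap
      have hdp : ∀ j, delSeq n p j ∈ Icc (0 : ℝ) 1 := fun j => by
        unfold delSeq; split_ifs <;> exact hp _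
      have h1 := ih m S hSn (Or.inl hSne) (delSeq n p) hdp
      have hsum : ∑ j ∈ Finset.Ico n (n + m), delSeq n p j =
          ∑ j ∈ Finset.Ico (n + 1) (n + 1 + m), p j := by
        rw [show n + 1 + m = n + m + 1 by omega, ← Finset.sum_Ico_add' p n (n + m) 1]
        refine Finset.sum_congr rfl fun j hj => ?_
        simp [delSeq, (Finset.mem_Ico.1 hj).1]
      rw [hsum, stateMean_congr (q := p) (S' := S) (fun k hk => by simp [delSeq, hk])
        (fun _ _ => Iff.rfl)] at h1
      have h2 := ih 0 S hSn (Or.inl hSne) p hp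
      simp only [add_zero, Finset.Ico_self, Finset.sum_empty, Finset.union_empty] at h2
      have h3 := hblock (n + 1) (n + 1 + m) (by omega) p hp
      have hw := gapWeight_mem hr (hp n).1
      refine hgap.trans (add_le_add (mul_le_mul_of_nonneg_left h1 hw.1)
        (mul_le_mul_of_nonneg_left (mul_le_mul h2 h3 (h𝓕_nonneg _ _ hp) ?_) (sub_nonneg.2 hw.2)))
      exact stateMean_nonneg hr (fun j => (hp j).1) (fun x hx => (hf x hx).1)
        fun x hx => (hf x hx).1

/-- Every sequence in `[0, 1]` is the sequence of probabilities of a given element, the remaining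
probability being put on `none`. Hence the bounds `𝓕 S p` are nonnegative for all such `p`. -/
theorem exists_coordinate_eq {L : Type} [Fintype L] (i : L) {p : ℕ → ℝ}
    (hp : ∀ j, p j ∈ Icc (0 : ℝ) 1) :
    ∃ P : ℕ → stdSimplex ℝ (Option L), ∀ j, (P j : Option L → ℝ) (some i) = p j := by
  classical
  refine ⟨fun j => ⟨fun k => if k = some i then p j else if k = none then 1 - p j else 0, ?_, ?_⟩, ?_⟩
  · intro k
    have := hp j
    dsimp only
    split_ifs <;> linarith [this.1, this.2]
  · simp [Fintype.sum_option]
  · exact fun j => if_pos rfl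

/-- Put all probability on one element. Among `n + 1` further elements, all of probability `0`, some
one wins the first time step with probability at most `1 / (n + 1)`, so `f 0 ≥ 1 - 1 / (n + 1)`. -/
theorem eval_zero_eq_one_of_OCS {f : ℝ → ℝ} {r : ℝ} (hf : ∀ x, 0 ≤ x → f x ∈ Icc (0 : ℝ) 1)
    (hOCS : ∀ (L : Type) [Fintype L] [Nonempty L],
      ∃ A : ContinuousOCS L, A.HasParameters f r) : f 0 = 1 := by
  refine le_antisymm (hf 0 le_rfl).2 ?_
  have key : ∀ n : ℕ, 1 - 1 / ((n : ℝ) + 1) ≤ f 0 := by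
    intro n
    obtain ⟨A, 𝓕, h𝓕, hA⟩ := hOCS (Option (Fin (n + 1)))
    classical
    let P : ℕ → stdSimplex ℝ (Option (Fin (n + 1))) := fun _ =>
      ⟨Pi.single none 1, single_mem_stdSimplex ℝ none⟩
    have hmeas : ∀ o, MeasurableSet (A.output P 0 ⁻¹' {o}) := fun o => A.measurableSet_act 0 _ o
    have hsum : ∑ i : Fin (n + 1), A.μ.real (A.output P 0 ⁻¹' {some i}) ≤ 1 := by
      rw [← measureReal_biUnion_finset
        (fun i _ j _ hij => Disjoint.preimage _ (by simpa using hij)) (fun i _ => hmeas _)]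
      exact measureReal_le_one
    obtain ⟨i, -, hi⟩ : ∃ i ∈ Finset.univ,
        A.μ.real (A.output P 0 ⁻¹' {some i}) ≤ 1 / ((n : ℝ) + 1) := by
      refine Finset.exists_le_of_sum_le Finset.univ_nonempty (hsum.trans_eq ?_)
      simp
      field_simp
    have h1 := hA P (some i) {0}
    have h2 := h𝓕.consecutive (fun j => (P j : Option (Fin (n + 1)) → ℝ) (some i))
      (fun j => by simp [P]) 0 0 le_rfl
    have hset : {ω | ∀ j ∈ ({0} : Finset ℕ), A.output P j ω ≠ some i} =
        (A.output P 0 ⁻¹' {some i})ᶜ := by ext; simp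
    rw [hset, probReal_compl_eq_one_sub (hmeas _)] at h1
    simp only [Finset.Icc_self, Finset.sum_singleton] at h2
    have h3 : (P 0 : Option (Fin (n + 1)) → ℝ) (some i) = 0 := by simp [P]
    rw [h3] at h2
    linarith
  have hlim : Tendsto (fun n : ℕ => 1 - 1 / ((n : ℝ) + 1)) atTop (𝓝 (1 - 0)) :=
    tendsto_const_nhds.sub tendsto_one_div_add_atTop_nhds_zero_nat
  rw [sub_zero] at hlim
  exact le_of_tendsto' hlim key

theorem ContinuousOCS.HasParameters.measureReal_le {L : Type} [Fintype L]
    {A : ContinuousOCS (Option L)} {f : ℝ → ℝ} {r : ℝ} (hA : A.HasParameters f r) (hr : 0 ≤ r)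
    (hf : ∀ x, 0 ≤ x → f x ∈ Icc (0 : ℝ) 1) (hf0 : f 0 = 1)
    (P : ℕ → stdSimplex ℝ (Option L)) (i : L) (n : ℕ) (S : Set ℕ) :
    A.μ.real {ω | ∀ j < n, j ∈ S → A.output P j ω ≠ some i} ≤
      stateMean f r (fun j => (P j : Option L → ℝ) (some i)) S n f := by
  classical
  obtain ⟨𝓕, h𝓕, hA⟩ := hA
  have hcoord : ∀ (P : ℕ → stdSimplex ℝ (Option L)) j,
      (P j : Option L → ℝ) (some i) ∈ Icc (0 : ℝ) 1 := fun P j =>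
    mem_Icc_of_mem_stdSimplex (P j).2 (some i)
  have hnonneg : ∀ S p, (∀ j, p j ∈ Icc (0 : ℝ) 1) → 0 ≤ 𝓕 S p := by
    intro S p hp
    obtain ⟨Q, hQ⟩ := exists_coordinate_eq i hp
    have := hA Q (some i) S
    simp only [hQ] at this
    exact measureReal_nonneg.trans this
  by_cases hne : ∃ j < n, j ∈ S
  · have h := h𝓕.le_stateMean hr hf hf0 hnonneg n 0 ((Finset.range n).filter (· ∈ S))
      (fun j hj => by simp at hj; exact hj.1)
      (Or.inl (by obtain ⟨j, hj, hjS⟩ := hne; exact ⟨j, by simp [hj, hjS]⟩))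
      _ (hcoord P)
    simp only [add_zero, Finset.Ico_self, Finset.sum_empty, Finset.union_empty] at h
    have h' := (hA P (some i) _).trans h
    rw [stateMean_congr (q := fun j => (P j : Option L → ℝ) (some i)) (S' := S)
      (fun _ _ => rfl) (fun k hk => by simp [hk])] at h'
    refine le_trans (le_of_eq ?_) h'
    congr 1
    ext ω
    simp
  · -- nothing is known about `𝓕 ∅`, but `stateMean` is `1` here
    push Not at hne
    rw [stateMean_eq_apply_zero hf0 hne, hf0]
    exact measureReal_le_one

/-! ### Balanced probability vectors -/

/-- A probability vector maximizing `∑ₖ ∫₀^{pₖ} φₖ` is balanced: moving towards any vertex `i` does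
not increase the objective, which says `φᵢ(pᵢ) ≤ ∑ₖ pₖ φₖ(pₖ)`. -/
theorem exists_balanced {ι : Type*} [Fintype ι] [Nonempty ι] (φ : ι → ℝ → ℝ)
    (hφ : ∀ i, ContinuousOn (φ i) (Ici 0)) :
    ∃ p : stdSimplex ℝ ι, ∀ i, φ i ((p : ι → ℝ) i) ≤ ∑ k, (p : ι → ℝ) k * φ k ((p : ι → ℝ) k) := by
  classical
  have hcont : ∀ i, Continuous fun x => φ i (max x 0) := fun i =>
    (hφ i).comp_continuous (by fun_prop) (fun x => le_max_right x 0)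
  -- `φ` is only controlled on `[0, ∞)`, hence the truncation
  set Ψ : (ι → ℝ) → ℝ := fun p => ∑ k, ∫ x in (0 : ℝ)..p k, φ k (max x 0) with hΨ
  have hderiv : ∀ p : ι → ℝ, HasFDerivAt Ψ
      (∑ k, φ k (max (p k) 0) • (ContinuousLinearMap.proj k : (ι → ℝ) →L[ℝ] ℝ)) p := by
    intro p
    refine HasFDerivAt.fun_sum fun k _ => ?_
    have h1 : HasDerivAt (fun y => ∫ x in (0 : ℝ)..y, φ k (max x 0)) (φ k (max (p k) 0)) (p k) :=
      intervalIntegral.integral_hasDerivAt_right ((hcont k).intervalIntegrable _ _)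
        (hcont k).stronglyMeasurable.stronglyMeasurableAtFilter (hcont k).continuousAt
    exact h1.comp_hasFDerivAt p (ContinuousLinearMap.proj k : (ι → ℝ) →L[ℝ] ℝ).hasFDerivAt
  obtain ⟨p, hp, hmax⟩ := (isCompact_stdSimplex ℝ ι).exists_isMaxOn
    ⟨_, single_mem_stdSimplex ℝ (Classical.arbitrary ι)⟩
    (fun p _ => (hderiv p).continuousAt.continuousWithinAt : ContinuousOn Ψ (stdSimplex ℝ ι))
  refine ⟨⟨p, hp⟩, fun i => ?_⟩
  have h := hmax.localize.hasFDerivWithinAt_nonpos (hderiv p).hasFDerivWithinAt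
    (sub_mem_posTangentConeAt_of_segment_subset
      ((convex_stdSimplex ℝ ι).segment_subset hp (single_mem_stdSimplex ℝ i)))
  have hmax0 : ∀ k, max (p k) 0 = p k := fun k => max_eq_left (hp.1 k)
  simp only [hmax0, sum_apply, smul_apply,
    ContinuousLinearMap.proj_apply, Pi.sub_apply, smul_eq_mul, mul_sub, Finset.sum_sub_distrib] at h
  have h2 : ∑ k, φ k (p k) * (Pi.single i 1 : ι → ℝ) k = φ i (p i) := by
    simp [Pi.single_apply]
  rw [h2] at h
  have h3 : ∑ k, φ k (p k) * p k = ∑ k, p k * φ k (p k) :=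
    Finset.sum_congr rfl fun k _ => mul_comm _ _
  exact h3 ▸ sub_nonpos.1 h

/-- A probability vector `p` with `φᵢ(pᵢ) ≤ ∑ₖ pₖ φₖ(pₖ)` for all `i`, if there is one. -/
noncomputable def balancedPoint {ι : Type*} [Fintype ι] [Nonempty ι] (φ : ι → ℝ → ℝ) :
    stdSimplex ℝ ι :=
  Classical.epsilon fun p => ∀ i, φ i ((p : ι → ℝ) i) ≤ ∑ k, (p : ι → ℝ) k * φ k ((p : ι → ℝ) k)

theorem balancedPoint_spec {ι : Type*} [Fintype ι] [Nonempty ι] {φ : ι → ℝ → ℝ}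
    (hφ : ∀ i, ContinuousOn (φ i) (Ici 0)) (i : ι) :
    φ i ((balancedPoint φ : ι → ℝ) i) ≤
      ∑ k, (balancedPoint φ : ι → ℝ) k * φ k ((balancedPoint φ : ι → ℝ) k) :=
  Classical.epsilon_spec (exists_balanced φ hφ) i

/-! ### Primal-dual accounting at one offline vertex -/

theorem integrableOn_Ioi_of_bounded_of_eq_zero {F : ℝ → ℝ} {C M : ℝ} (hF : Measurable F)
    (hC : ∀ t, |F t| ≤ C) (hM : ∀ t, M < t → F t = 0) : IntegrableOn F (Ioi 0) := by
  have h1 : IntegrableOn F (Ioc 0 M) :=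
    Measure.integrableOn_of_bounded (M := C) measure_Ioc_lt_top.ne hF.aestronglyMeasurable
      (ae_of_all _ hC)
  refine (h1.integrable_indicator measurableSet_Ioc).integrableOn.congr_fun (fun t ht => ?_)
    measurableSet_Ioi
  by_cases h : t ≤ M
  · exact indicator_of_mem (show t ∈ Ioc 0 M from ⟨ht, h⟩) F
  · rw [indicator_of_notMem (fun h' => h h'.2), hM t (not_le.1 h)]

theorem exists_bound_of_lt (v : ℕ → ℝ) (n : ℕ) : ∃ M, ∀ k < n, v k ≤ M :=
  let ⟨M, hM⟩ := ((Set.finite_lt_nat n).image v).bddAbove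
  ⟨M, fun _ hk => hM (mem_image_of_mem v hk)⟩

theorem integrableOn_ite_le (c x : ℝ) :
    IntegrableOn (fun t : ℝ => if t ≤ x then c else 0) (Ioi 0) :=
  integrableOn_Ioi_of_bounded_of_eq_zero (C := |c|) (M := x)
    (Measurable.ite measurableSet_Iic measurable_const measurable_const)
    (fun t => by split_ifs <;> simp) (fun t ht => if_neg (not_le.2 ht))

theorem integral_ite_le (c : ℝ) {x : ℝ} (hx : 0 ≤ x) :
    ∫ t in Ioi (0 : ℝ), (if t ≤ x then c else 0) = c * x := by
  have h : (fun t : ℝ => if t ≤ x then c else 0) = (Iic x).indicator fun _ => c := by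
    ext t; simp [indicator_apply]
  rw [h, setIntegral_indicator measurableSet_Iic, Ioi_inter_Iic]
  simp [hx, mul_comm]

/-- The marginal dual value, at weight level `t`, of assigning a further bit of the online vertex `n`
to an offline vertex to which `x` of it has been assigned. Here `v j` is the weight of the edge to
the online vertex `j` and `p j` the probability assigned to it at earlier times, so at level `t` the
relevant time steps are `{j | t ≤ v j}`. If `n` is one of them, the value is the price `G` of the
extended run; otherwise the step is a gap, and the loss it causes is charged. -/
noncomputable def levelValue (f G : ℝ → ℝ) (Γ r : ℝ) (p v : ℕ → ℝ) (n : ℕ) (x t : ℝ) : ℝ :=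
  if t ≤ v n then stateMean f r p {j | t ≤ v j} n (fun y => G (y + x))
  else -(r * stateMean f r p {j | t ≤ v j} n (fun y => G y - Γ * f y))

/-- The marginal dual value `levelValue`, summed over all weight levels. -/
noncomputable def marginalValue (f G : ℝ → ℝ) (Γ r : ℝ) (p v : ℕ → ℝ) (n : ℕ) (x : ℝ) : ℝ :=
  ∫ t in Ioi (0 : ℝ), levelValue f G Γ r p v n x t

theorem marginalValue_congr {f G : ℝ → ℝ} {Γ r : ℝ} {p q v v' : ℕ → ℝ} {n : ℕ}
    (hp : ∀ k < n, p k = q k) (hv : ∀ k ≤ n, v k = v' k) (x : ℝ) :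
    marginalValue f G Γ r p v n x = marginalValue f G Γ r q v' n x := by
  have h : ∀ t h, stateMean f r p {j | t ≤ v j} n h = stateMean f r q {j | t ≤ v' j} n h :=
    fun t h => stateMean_congr hp (fun k hk => by simp [hv k hk.le]) h
  simp only [marginalValue, levelValue, h, hv n le_rfl]

namespace IsDualProfile

variable {f G : ℝ → ℝ} {Γ r : ℝ} {p v : ℕ → ℝ} {S : Set ℕ} {n T : ℕ}

theorem Γ_nonneg (hG : IsDualProfile f G Γ r) : 0 ≤ Γ := hG.G_zero ▸ hG.G_nonneg 0 le_rfl

theorem G_le (hG : IsDualProfile f G Γ r) {x : ℝ} (hx : 0 ≤ x) : G x ≤ Γ :=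
  hG.G_zero ▸ hG.G_antitone self_mem_Ici hx hx

theorem f_nonneg (hG : IsDualProfile f G Γ r) (x : ℝ) (hx : 0 ≤ x) : 0 ≤ f x := (hG.f_mem x hx).1

theorem loss_nonneg (hG : IsDualProfile f G Γ r) (hr : 0 ≤ r) (hp : ∀ j, 0 ≤ p j) :
    0 ≤ stateMean f r p S n (fun y => G y - Γ * f y) :=
  stateMean_nonneg hr hp hG.f_nonneg fun x hx => sub_nonneg.2 (hG.mul_f_le x hx)

theorem stateMean_loss_eq :
    stateMean f r p S n (fun y => G y - Γ * f y) =
      stateMean f r p S n G - Γ * stateMean f r p S n f := by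
  rw [stateMean_sub G fun y => Γ * f y, stateMean_const_mul]

/-- The dual variable `Γ - stateMean … G` of a weight level never decreases. -/
theorem antitone_stateMean (hG : IsDualProfile f G Γ r) (hr : 0 ≤ r) (hp : ∀ j, 0 ≤ p j) :
    Antitone fun n => stateMean f r p S n G := by
  refine antitone_nat_of_succ_le fun n => ?_
  by_cases hn : n ∈ S
  · rw [stateMean_succ_of_mem hn]
    exact stateMean_mono hr hp hG.f_nonneg fun x hx =>
      hG.G_antitone hx (add_nonneg hx (hp n) : (0 : ℝ) ≤ _) (by linarith [hp n])
  · rw [stateMean_succ_of_notMem hn, hG.G_zero]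
    have h1 := hG.loss_nonneg (S := S) (n := n) hr hp
    rw [stateMean_loss_eq] at h1
    have h2 := mul_nonneg (sub_nonneg.2 (gapWeight_mem hr (hp n)).2) h1
    linarith

theorem stateMean_G_le (hG : IsDualProfile f G Γ r) (hr : 0 ≤ r) (hp : ∀ j, 0 ≤ p j) :
    stateMean f r p S n G ≤ Γ :=
  stateMean_le hr hp hG.f_mem hG.Γ_nonneg fun _ hx => hG.G_le hx

/-- In one time step, the marginal value distributed at level `t` and the increase of the dual
variable `Γ - stateMean … G` are together at most the increase of the bound `1 - stateMean … f` on
the winning probability. -/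
theorem mul_levelValue_le (hG : IsDualProfile f G Γ r) (hr : 0 ≤ r) (hp : ∀ j, 0 ≤ p j) (t : ℝ) :
    p n * levelValue f G Γ r p v n (p n) t ≤
      (stateMean f r p {j | t ≤ v j} n f - stateMean f r p {j | t ≤ v j} n G) -
        (stateMean f r p {j | t ≤ v j} (n + 1) f - stateMean f r p {j | t ≤ v j} (n + 1) G) := by
  unfold levelValue
  set S : Set ℕ := {j | t ≤ v j}
  split_ifs with ht
  · have hn : n ∈ S := ht
    rw [stateMean_succ_of_mem hn, stateMean_succ_of_mem hn, ← stateMean_sub, ← stateMean_sub,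
      ← stateMean_sub, ← stateMean_const_mul]
    refine stateMean_mono hr hp hG.f_nonneg fun x hx => ?_
    have := hG.tangent_le x (x + p n) hx (add_nonneg hx (hp n))
    simpa using this
  · have hn : n ∉ S := ht
    rw [stateMean_succ_self_of_notMem hG.f_zero hn, stateMean_succ_of_notMem hn, hG.G_zero]
    have h1 := hG.loss_nonneg (S := S) (n := n) hr hp
    have h2 : 1 - r * p n ≤ max (1 - r * p n) 0 := le_max_left _ _
    have h3 := mul_le_mul_of_nonneg_right h2 h1
    rw [stateMean_loss_eq] at h3 ⊢
    linarith

theorem sum_mul_levelValue_le (hG : IsDualProfile f G Γ r) (hr : 0 ≤ r) (hp : ∀ j, 0 ≤ p j)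
    (t : ℝ) :
    ∑ n ∈ Finset.range T, p n * levelValue f G Γ r p v n (p n) t ≤
      (1 - stateMean f r p {j | t ≤ v j} T f) - (Γ - stateMean f r p {j | t ≤ v j} T G) := by
  induction T with
  | zero => simp [stateMean, hG.f_zero, hG.G_zero]
  | succ T ih =>
    rw [Finset.sum_range_succ]
    have := hG.mul_levelValue_le (v := v) (n := T) hr hp t
    linarith

/-- Dual feasibility at level `t`. Below the weight of the edge it holds with equality just after step
`n`; above the weight it is `gap_le`. -/
theorem ite_le_levelValue (hG : IsDualProfile f G Γ r) (hr : 0 ≤ r) (hp : ∀ j, 0 ≤ p j)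
    (hn : n < T) (t : ℝ) :
    (if t ≤ v n then Γ else 0) ≤
      (Γ - stateMean f r p {j | t ≤ v j} T G) + levelValue f G Γ r p v n (p n) t := by
  unfold levelValue
  set S : Set ℕ := {j | t ≤ v j}
  have hanti := hG.antitone_stateMean (S := S) hr hp
  split_ifs with ht
  · have h1 : stateMean f r p S T G ≤ stateMean f r p S (n + 1) G := hanti hn
    rw [stateMean_succ_of_mem (show n ∈ S from ht)] at h1
    linarith
  · have h1 : stateMean f r p S T G ≤ stateMean f r p S n G := hanti hn.le
    have h2 : stateMean f r p S n (fun y => G y - (-r) * (G y - Γ * f y)) ≤ Γ :=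
      stateMean_le hr hp hG.f_mem hG.Γ_nonneg fun x hx => by
        have := hG.gap_le x hx
        linarith
    rw [stateMean_sub G, stateMean_const_mul (-r) fun y => G y - Γ * f y] at h2
    linarith

theorem abs_stateMean_le (hG : IsDualProfile f G Γ r) (hr : 0 ≤ r) (hp : ∀ j, 0 ≤ p j)
    {h : ℝ → ℝ} {C : ℝ} (hh : ∀ x, 0 ≤ x → |h x| ≤ C) : |stateMean f r p S n h| ≤ C := by
  have hC : 0 ≤ C := (abs_nonneg _).trans (hh 0 le_rfl)
  refine abs_le'.2 ⟨stateMean_le hr hp hG.f_mem hC fun x hx => (abs_le'.1 (hh x hx)).1, ?_⟩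
  have := stateMean_const_mul (f := f) (r := r) (p := p) (S := S) (n := n) (-1) h
  rw [neg_one_mul] at this
  rw [← this]
  exact stateMean_le hr hp hG.f_mem hC fun x hx => by simpa using (abs_le'.1 (hh x hx)).2

theorem abs_G_le (hG : IsDualProfile f G Γ r) {x : ℝ} (hx : 0 ≤ x) : |G x| ≤ Γ := by
  rw [abs_of_nonneg (hG.G_nonneg x hx)]
  exact hG.G_le hx

theorem abs_loss_le (hG : IsDualProfile f G Γ r) {x : ℝ} (hx : 0 ≤ x) :
    |G x - Γ * f x| ≤ Γ := by
  rw [abs_of_nonneg (sub_nonneg.2 (hG.mul_f_le x hx))]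
  linarith [hG.G_le hx, mul_nonneg hG.Γ_nonneg (hG.f_nonneg x hx)]

theorem stateMean_level_of_lt (hG : IsDualProfile f G Γ r) {M t : ℝ} (hM : ∀ k < n, v k ≤ M)
    (ht : M < t) (h : ℝ → ℝ) : stateMean f r p {j | t ≤ v j} n h = h 0 :=
  stateMean_eq_apply_zero hG.f_zero
    (fun k hk (hk' : t ≤ v k) => absurd (hk'.trans (hM k hk)) (not_le.2 ht)) h

theorem integrableOn_stateMean (hG : IsDualProfile f G Γ r) (hr : 0 ≤ r) (hp : ∀ j, 0 ≤ p j)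
    {h : ℝ → ℝ} {C : ℝ} (hh : ∀ x, 0 ≤ x → |h x| ≤ C) :
    IntegrableOn (fun t => h 0 - stateMean f r p {j | t ≤ v j} n h) (Ioi 0) := by
  obtain ⟨M, hM⟩ := exists_bound_of_lt v n
  refine integrableOn_Ioi_of_bounded_of_eq_zero (C := C + C) (M := M)
    (measurable_const.sub (measurable_stateMean h)) (fun t => ?_) fun t ht => ?_
  · exact (abs_sub _ _).trans (add_le_add (hh 0 le_rfl) (hG.abs_stateMean_le hr hp hh))
  · rw [hG.stateMean_level_of_lt hM ht, sub_self]

theorem integrableOn_one_sub (hG : IsDualProfile f G Γ r) (hr : 0 ≤ r) (hp : ∀ j, 0 ≤ p j) :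
    IntegrableOn (fun t => 1 - stateMean f r p {j | t ≤ v j} n f) (Ioi 0) := by
  have := hG.integrableOn_stateMean (v := v) (n := n) hr hp (h := f) (C := 1) fun x hx => by
    rw [abs_of_nonneg (hG.f_mem x hx).1]; exact (hG.f_mem x hx).2
  rwa [hG.f_zero] at this

theorem integrableOn_Γ_sub (hG : IsDualProfile f G Γ r) (hr : 0 ≤ r) (hp : ∀ j, 0 ≤ p j) :
    IntegrableOn (fun t => Γ - stateMean f r p {j | t ≤ v j} n G) (Ioi 0) := by
  have := hG.integrableOn_stateMean (v := v) (n := n) hr hp (h := G) fun x hx => hG.abs_G_le hx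
  rwa [hG.G_zero] at this

theorem integrableOn_levelValue (hG : IsDualProfile f G Γ r) (hr : 0 ≤ r) (hp : ∀ j, 0 ≤ p j)
    {x : ℝ} (hx : 0 ≤ x) : IntegrableOn (levelValue f G Γ r p v n x) (Ioi 0) := by
  obtain ⟨M, hM⟩ := exists_bound_of_lt v (n + 1)
  refine integrableOn_Ioi_of_bounded_of_eq_zero (C := Γ + r * Γ) (M := M)
    (Measurable.ite measurableSet_Iic (measurable_stateMean _)
      ((measurable_stateMean _).const_mul _).neg) (fun t => ?_) fun t ht => ?_
  · have hΓ := hG.Γ_nonneg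
    unfold levelValue
    split_ifs
    · have := hG.abs_stateMean_le (S := {j | t ≤ v j}) (n := n) hr hp (h := fun y => G (y + x))
        fun y hy => hG.abs_G_le (add_nonneg hy hx)
      linarith [mul_nonneg hr hΓ]
    · rw [abs_neg, abs_mul, abs_of_nonneg hr]
      have := hG.abs_stateMean_le (S := {j | t ≤ v j}) (n := n) hr hp
        (h := fun y => G y - Γ * f y) fun y hy => hG.abs_loss_le hy
      linarith [mul_le_mul_of_nonneg_left this hr]
  · unfold levelValue
    rw [if_neg (not_le.2 ((hM n n.lt_succ_self).trans_lt ht)),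
      hG.stateMean_level_of_lt (fun k hk => hM k (by omega)) ht, hG.f_zero, hG.G_zero]
    ring

theorem continuousOn_marginalValue (hG : IsDualProfile f G Γ r) (hr : 0 ≤ r)
    (hp : ∀ j, 0 ≤ p j) (hv : 0 ≤ v n) :
    ContinuousOn (marginalValue f G Γ r p v n) (Ici 0) := by
  obtain ⟨K, hK⟩ := hG.G_lipschitz
  have hK0 : 0 ≤ K := by
    have h1 := hK 0 1 le_rfl zero_le_one
    have h2 := hG.G_antitone self_mem_Ici (zero_le_one : (0 : ℝ) ≤ 1) zero_le_one
    linarith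
  have key : ∀ x y, 0 ≤ x → x ≤ y →
      0 ≤ marginalValue f G Γ r p v n x - marginalValue f G Γ r p v n y ∧
      marginalValue f G Γ r p v n x - marginalValue f G Γ r p v n y ≤ K * v n * (y - x) := by
    intro x y hx hxy
    have hy := hx.trans hxy
    have hd : marginalValue f G Γ r p v n x - marginalValue f G Γ r p v n y =
        ∫ t in Ioi (0 : ℝ), (levelValue f G Γ r p v n x t - levelValue f G Γ r p v n y t) :=
      (integral_sub (hG.integrableOn_levelValue hr hp hx)
        (hG.integrableOn_levelValue hr hp hy)).symm
    rw [hd]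
    constructor
    · refine setIntegral_nonneg measurableSet_Ioi fun t _ => ?_
      unfold levelValue
      split_ifs
      · exact sub_nonneg.2 (stateMean_mono hr hp hG.f_nonneg fun z hz =>
          hG.G_antitone (add_nonneg hz hx : (0 : ℝ) ≤ _) (add_nonneg hz hy : (0 : ℝ) ≤ _)
            (by linarith))
      · simp
    · have : K * v n * (y - x) = K * (y - x) * v n := by ring
      rw [this, ← integral_ite_le _ hv]
      refine setIntegral_mono ((hG.integrableOn_levelValue hr hp hx).sub
        (hG.integrableOn_levelValue hr hp hy)) (integrableOn_ite_le _ _) fun t => ?_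
      unfold levelValue
      dsimp only
      split_ifs
      · rw [← stateMean_sub]
        refine stateMean_le hr hp hG.f_mem (mul_nonneg hK0 (sub_nonneg.2 hxy)) fun z hz => ?_
        have := hK (z + x) (z + y) (add_nonneg hz hx) (by linarith)
        linarith
      · simp
  refine (LipschitzOnWith.of_dist_le_mul (K := (K * v n).toNNReal) fun x hx y hy => ?_).continuousOn
  rw [Real.coe_toNNReal _ (mul_nonneg hK0 hv), Real.dist_eq, Real.dist_eq]
  rcases le_total x y with h | h
  · have := key x y hx h
    rw [abs_of_nonneg this.1, abs_sub_comm x y, abs_of_nonneg (sub_nonneg.2 h)]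
    exact this.2
  · have := key y x hy h
    rw [abs_sub_comm, abs_of_nonneg this.1, abs_of_nonneg (sub_nonneg.2 h)]
    exact this.2

/-- Dual feasibility of the edge to the online vertex `n`. -/
theorem mul_le_dual (hG : IsDualProfile f G Γ r) (hr : 0 ≤ r) (hp : ∀ j, 0 ≤ p j)
    (hn : n < T) (hv : 0 ≤ v n) :
    Γ * v n ≤ (∫ t in Ioi (0 : ℝ), (Γ - stateMean f r p {j | t ≤ v j} T G)) +
      marginalValue f G Γ r p v n (p n) := by
  have h1 := hG.integrableOn_Γ_sub (v := v) (n := T) hr hp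
  have h2 := hG.integrableOn_levelValue (v := v) (n := n) hr hp (hp n)
  rw [← integral_ite_le _ hv, marginalValue, ← integral_add h1 h2]
  exact setIntegral_mono (integrableOn_ite_le _ _) (h1.add h2)
    fun t => hG.ite_le_levelValue hr hp hn t

/-- The share of one offline vertex in the dual objective is at most the lower bound on its expected
weight that `stateMean` provides. -/
theorem dual_le_primal (hG : IsDualProfile f G Γ r) (hr : 0 ≤ r) (hp : ∀ j, 0 ≤ p j) :
    (∫ t in Ioi (0 : ℝ), (Γ - stateMean f r p {j | t ≤ v j} T G)) +
      ∑ n ∈ Finset.range T, p n * marginalValue f G Γ r p v n (p n) ≤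
    ∫ t in Ioi (0 : ℝ), (1 - stateMean f r p {j | t ≤ v j} T f) := by
  have h1 := hG.integrableOn_Γ_sub (v := v) (n := T) hr hp
  have h2 : ∀ n ∈ Finset.range T,
      IntegrableOn (fun t => p n * levelValue f G Γ r p v n (p n) t) (Ioi 0) := fun n _ =>
    (hG.integrableOn_levelValue hr hp (hp n)).const_mul _
  simp only [marginalValue, ← integral_const_mul]
  rw [← integral_finsetSum _ h2, ← integral_add h1 (integrable_finsetSum _ h2)]
  refine setIntegral_mono (h1.add (integrable_finsetSum _ h2)) (hG.integrableOn_one_sub hr hp) fun t => ?_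
  have := hG.sum_mul_levelValue_le (v := v) (T := T) hr hp t
  dsimp only
  linarith

end IsDualProfile

/-! ### The matching algorithm -/

section Allocation

variable {L : Type} [Fintype L]

/-- The probability vectors handed to the OCS on `Option L`, where `none` stands for discarding: at
each time the marginal values are balanced, that of `none` being `0`. The probabilities that enter
`marginalValue` at times `k ≥ n` are irrelevant and set to `0` to make the recursion well-founded. -/
noncomputable def allocation (f G : ℝ → ℝ) (Γ r : ℝ) (w : ℕ → L → ℝ) (n : ℕ) :
    stdSimplex ℝ (Option L) :=
  balancedPoint fun o x => o.elim 0 fun i => marginalValue f G Γ r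
    (fun k => if _h : k < n then (allocation f G Γ r w k : Option L → ℝ) (some i) else 0)
    (fun j => w j i) n x
termination_by n

theorem allocation_eq (f G : ℝ → ℝ) (Γ r : ℝ) (w : ℕ → L → ℝ) (n : ℕ) :
    allocation f G Γ r w n = balancedPoint fun o x => o.elim 0 fun i => marginalValue f G Γ r
      (fun k => (allocation f G Γ r w k : Option L → ℝ) (some i)) (fun j => w j i) n x := by
  rw [allocation]
  congr! 5 with o x i
  exact marginalValue_congr (fun k hk => by simp [hk]) (fun _ _ => rfl) x

theorem allocation_congr (f G : ℝ → ℝ) (Γ r : ℝ) {w w' : ℕ → L → ℝ} {n : ℕ}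
    (h : ∀ k ≤ n, w k = w' k) : allocation f G Γ r w n = allocation f G Γ r w' n := by
  induction n using Nat.strong_induction_on with
  | _ n ih =>
    rw [allocation_eq, allocation_eq f G Γ r w']
    congr! 5 with o x i
    exact marginalValue_congr
      (fun k hk => by rw [ih k hk fun l hl => h l (hl.trans hk.le)])
      (fun k hk => by rw [h k hk]) x

theorem allocation_nonneg (f G : ℝ → ℝ) (Γ r : ℝ) (w : ℕ → L → ℝ) (o : Option L) (n : ℕ) :
    0 ≤ (allocation f G Γ r w n : Option L → ℝ) o :=
  (allocation f G Γ r w n).2.1 o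

/-- The dual variable of the online vertex `n`: the average of the marginal values with respect to the
allocation. -/
noncomputable def price (f G : ℝ → ℝ) (Γ r : ℝ) (w : ℕ → L → ℝ) (n : ℕ) : ℝ :=
  ∑ i, (allocation f G Γ r w n : Option L → ℝ) (some i) * marginalValue f G Γ r
    (fun k => (allocation f G Γ r w k : Option L → ℝ) (some i)) (fun j => w j i) n
    ((allocation f G Γ r w n : Option L → ℝ) (some i))

/-- For `o = none`, this says that the prices are nonnegative. -/
theorem IsDualProfile.elim_le_price {f G : ℝ → ℝ} {Γ r : ℝ} (hG : IsDualProfile f G Γ r)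
    (hr : 0 ≤ r) {w : ℕ → L → ℝ} (hw : ∀ j i, 0 ≤ w j i) (n : ℕ) (o : Option L) :
    (o.elim 0 fun i => marginalValue f G Γ r
      (fun k => (allocation f G Γ r w k : Option L → ℝ) (some i)) (fun j => w j i) n
      ((allocation f G Γ r w n : Option L → ℝ) o)) ≤ price f G Γ r w n := by
  set φ : Option L → ℝ → ℝ := fun o x => o.elim 0 fun i => marginalValue f G Γ r
      (fun k => (allocation f G Γ r w k : Option L → ℝ) (some i)) (fun j => w j i) n x with hφ
  have hcont : ∀ o, ContinuousOn (φ o) (Ici 0) := by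
    rintro (_ | i)
    · exact continuousOn_const
    · exact hG.continuousOn_marginalValue hr (fun k => allocation_nonneg f G Γ r w (some i) k)
        (hw n i)
  have h := balancedPoint_spec hcont o
  rw [← allocation_eq] at h
  refine h.trans_eq ?_
  rw [Fintype.sum_option]
  simp [hφ, price]

/-- The sequence of weight vectors `x`, continued by vertices without edges. -/
def extendZero {T : ℕ} (x : Fin T → L → ℝ≥0) (j : ℕ) (i : L) : ℝ :=
  if h : j < T then x ⟨j, h⟩ i else 0

/-- The matching algorithm that runs the OCS `A` on the sequence of allocations and follows its
selections. -/
noncomputable def matchingOfOCS (A : ContinuousOCS (Option L)) (f G : ℝ → ℝ) (Γ r : ℝ) :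
    OnlineMatchingAlgorithm L where
  Ω := A.Ω
  μ := A.μ
  act j x := A.act j (fun k => allocation f G Γ r (extendZero x) k)
  measurableSet_act j _ o := A.measurableSet_act j _ o

/-- As allocations depend only on the weights seen so far, the outputs on an instance are those of `A`
on one fixed sequence of probability vectors. -/
theorem outputs_matchingOfOCS (A : ContinuousOCS (Option L)) (f G : ℝ → ℝ) (Γ r : ℝ) {T : ℕ}
    (w : Fin T → L → ℝ≥0) (ω : A.Ω) (j : Fin T) :
    (matchingOfOCS A f G Γ r).outputs w ω j =
      A.output (allocation f G Γ r (extendZero w)) j ω := by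
  change A.act j (fun k : Fin (j + 1) => allocation f G Γ r
    (extendZero fun k : Fin (j + 1) => w (Fin.castLE j.isLt k)) k) ω = A.act j _ ω
  congr 1
  funext k
  refine allocation_congr f G Γ r fun l hl => ?_
  have h1 : l < j + 1 := hl.trans_lt k.isLt
  have h2 : l < T := by omega
  funext i
  simp [extendZero, h1, h2]

end Allocation

/-- Weak duality for the matching linear program. -/
theorem offlineOpt_le_of_dual {L : Type} [Fintype L] [DecidableEq L] {T : ℕ}
    (w : Fin T → L → ℝ≥0) {Γ : ℝ} {α : L → ℝ} {β : Fin T → ℝ}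
    (hα : ∀ i, 0 ≤ α i) (hβ : ∀ j, 0 ≤ β j) (h : ∀ i j, Γ * w j i ≤ α i + β j) :
    Γ * (offlineOpt w : ℝ) ≤ ∑ i, α i + ∑ j, β j := by
  obtain ⟨σ, -, hσ⟩ := Finset.exists_mem_eq_sup (Finset.univ : Finset (Fin T → Option L))
    Finset.univ_nonempty (fun σ => assignmentWeight w σ)
  rw [offlineOpt, hσ, assignmentWeight, NNReal.coe_sum, Finset.mul_sum]
  have hsum : ∑ j, β j = ∑ o, ∑ j with σ j = o, β j :=
    (Finset.sum_fiberwise Finset.univ σ β).symm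
  rw [Fintype.sum_option] at hsum
  have hnone : 0 ≤ ∑ j with σ j = none, β j := Finset.sum_nonneg fun j _ => hβ j
  have hi : ∀ i, Γ * (((Finset.univ.filter fun j => σ j = some i).sup fun j => w j i : ℝ≥0) : ℝ) ≤
      α i + ∑ j with σ j = some i, β j := by
    intro i
    rcases (Finset.univ.filter fun j => σ j = some i).eq_empty_or_nonempty with he | hne
    · simp [he, hα i]
    · obtain ⟨j, hj, hsup⟩ := Finset.exists_mem_eq_sup _ hne fun j => w j i
      rw [hsup]
      exact (h i j).trans (add_le_add le_rfl (Finset.single_le_sum (fun j _ => hβ j) hj))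
  have := Finset.sum_le_sum fun i (_ : i ∈ Finset.univ) => hi i
  rw [Finset.sum_add_distrib] at this
  linarith

/-- The expected weight by the layer cake formula, with `F i t` bounding the probability that no online
vertex of weight at least `t` is matched to `i`. -/
theorem OnlineMatchingAlgorithm.le_integral_assignmentWeight {L : Type} [Fintype L]
    [DecidableEq L] (B : OnlineMatchingAlgorithm L) {T : ℕ} (w : Fin T → L → ℝ≥0)
    (F : L → ℝ → ℝ) (hF : ∀ i, IntegrableOn (fun t => 1 - F i t) (Ioi 0))
    (hmiss : ∀ i (t : ℝ), 0 < t →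
      B.μ.real {ω | ∀ j, t ≤ w j i → B.outputs w ω j ≠ some i} ≤ F i t) :
    ∑ i, ∫ t in Ioi (0 : ℝ), (1 - F i t) ≤
      ∫ ω, (assignmentWeight w (B.outputs w ω) : ℝ) ∂B.μ := by
  set X : L → B.Ω → ℝ≥0 := fun i ω =>
    (Finset.univ.filter fun j => B.outputs w ω j = some i).sup fun j => w j i with hX
  have hmem : ∀ j i, MeasurableSet {ω | B.outputs w ω j = some i} := fun j i =>
    B.measurableSet_act j _ (some i)
  have hset : ∀ i (t : ℝ), 0 < t →
      {ω | t ≤ (X i ω : ℝ)} = {ω | ∀ j, t ≤ w j i → B.outputs w ω j ≠ some i}ᶜ := by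
    intro i t ht
    lift t to ℝ≥0 using ht.le
    ext ω
    have h := Finset.le_sup_iff (s := Finset.univ.filter fun j => B.outputs w ω j = some i)
      (f := fun j => w j i) (a := t) (by exact_mod_cast ht)
    simp only [Finset.mem_filter, Finset.mem_univ, true_and] at h
    simp only [mem_ofPred_eq, mem_compl_iff, hX, NNReal.coe_le_coe]
    rw [h]
    push Not
    exact exists_congr fun j => and_comm
  have hmiss_meas : ∀ i (t : ℝ),
      MeasurableSet {ω | ∀ j, t ≤ w j i → B.outputs w ω j ≠ some i} := by
    intro i t
    simp only [ofPred_forall]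
    exact MeasurableSet.iInter fun j => MeasurableSet.iInter fun _ => (hmem j i).compl
  have hXmeas : ∀ i, Measurable fun ω => (X i ω : ℝ) := by
    intro i
    refine measurable_of_Ici fun t => ?_
    rcases le_or_gt t 0 with ht | ht
    · have : (fun ω => (X i ω : ℝ)) ⁻¹' Ici t = univ :=
        eq_univ_of_forall fun ω => ht.trans (X i ω).2
      rw [this]
      exact MeasurableSet.univ
    · have := (hmiss_meas i t).compl
      rwa [← hset i t ht] at this
  have hXle : ∀ i ω, (X i ω : ℝ) ≤ (Finset.univ.sup fun j => w j i : ℝ≥0) := fun i ω => by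
    exact_mod_cast Finset.sup_mono (Finset.filter_subset _ _)
  have hXint : ∀ i, Integrable (fun ω => (X i ω : ℝ)) B.μ := fun i =>
    Integrable.of_bound (hXmeas i).aestronglyMeasurable
      (Finset.univ.sup fun j => w j i : ℝ≥0) (ae_of_all _ fun ω => by
      rw [Real.norm_of_nonneg (NNReal.coe_nonneg _)]; exact hXle i ω)
  have hw : ∫ ω, (assignmentWeight w (B.outputs w ω) : ℝ) ∂B.μ = ∑ i, ∫ ω, (X i ω : ℝ) ∂B.μ := by
    rw [← integral_finsetSum _ fun i _ => hXint i]
    simp [assignmentWeight, hX]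
  rw [hw]
  refine Finset.sum_le_sum fun i _ => ?_
  rw [(hXint i).integral_eq_integral_meas_le (ae_of_all _ fun ω => (X i ω).2)]
  have htail : IntegrableOn (fun t : ℝ => B.μ.real {ω | t ≤ (X i ω : ℝ)}) (Ioi 0) := by
    have hanti : Antitone fun t : ℝ => B.μ.real {ω | t ≤ (X i ω : ℝ)} := fun s t hst =>
      measureReal_mono fun ω (hω : t ≤ _) => hst.trans hω
    refine integrableOn_Ioi_of_bounded_of_eq_zero (C := 1)
      (M := (Finset.univ.sup fun j => w j i : ℝ≥0)) hanti.measurable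
      (fun t => by rw [abs_of_nonneg measureReal_nonneg]; exact measureReal_le_one) fun t ht => ?_
    have : {ω | t ≤ (X i ω : ℝ)} = ∅ :=
      eq_empty_of_forall_notMem fun ω (hω : t ≤ _) => not_le.2 ht (hω.trans (hXle i ω))
    rw [this, measureReal_empty]
  refine setIntegral_mono_on (hF i) htail measurableSet_Ioi fun t ht => ?_
  rw [hset i t ht, probReal_compl_eq_one_sub (hmiss_meas i t)]
  have := hmiss i t ht
  linarith

theorem matchingOfOCS_isCompetitive {L : Type} [Fintype L] [DecidableEq L] {f G : ℝ → ℝ}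
    {Γ r : ℝ} (hG : IsDualProfile f G Γ r) (hr : 0 ≤ r) {A : ContinuousOCS (Option L)}
    (hA : A.HasParameters f r) : (matchingOfOCS A f G Γ r).IsCompetitive Γ := by
  intro T w
  set W := extendZero w
  have hW : ∀ j i, 0 ≤ W j i := fun j i => by
    simp only [W, extendZero]
    split_ifs
    exacts [NNReal.coe_nonneg _, le_rfl]
  have hWw : ∀ (j : Fin T) i, W j i = w j i := fun j i => by simp [W, extendZero]
  set p : L → ℕ → ℝ := fun i k => (allocation f G Γ r W k : Option L → ℝ) (some i)
  have hp : ∀ i k, 0 ≤ p i k := fun i k => allocation_nonneg f G Γ r W (some i) k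
  set α : L → ℝ := fun i =>
    ∫ t in Ioi (0 : ℝ), (Γ - stateMean f r (p i) {j | t ≤ W j i} T G)
  have hα : ∀ i, 0 ≤ α i := fun i => setIntegral_nonneg measurableSet_Ioi fun t _ =>
    sub_nonneg.2 (hG.stateMean_G_le hr (hp i))
  have hdual := offlineOpt_le_of_dual w (Γ := Γ) (α := α)
    (β := fun j : Fin T => price f G Γ r W j) hα
    (fun j => hG.elim_le_price hr hW j none) (fun i j => by
      have h1 := hG.mul_le_dual (v := fun j => W j i) hr (hp i) j.isLt (hW j i)
      have h2 := hG.elim_le_price hr hW j (some i)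
      simp only [hWw] at h1
      exact h1.trans (add_le_add le_rfl h2))
  have hprimal : ∑ i, α i + ∑ j : Fin T, price f G Γ r W j ≤
      ∑ i, ∫ t in Ioi (0 : ℝ), (1 - stateMean f r (p i) {j | t ≤ W j i} T f) := by
    rw [Fin.sum_univ_eq_sum_range (fun j => price f G Γ r W j) T]
    simp only [price]
    rw [Finset.sum_comm, ← Finset.sum_add_distrib]
    exact Finset.sum_le_sum fun i _ => hG.dual_le_primal hr (hp i)
  refine hdual.trans (hprimal.trans ((matchingOfOCS A f G Γ r).le_integral_assignmentWeight w
    (fun i t => stateMean f r (p i) {j | t ≤ W j i} T f)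
    (fun i => hG.integrableOn_one_sub hr (hp i)) fun i t _ => ?_))
  refine le_trans (le_of_eq ?_) (hA.measureReal_le hr hG.f_mem hG.f_zero
    (allocation f G Γ r W) i T {j | t ≤ W j i})
  change A.μ.real {ω : A.Ω | ∀ j : Fin T, t ≤ w j i →
    (matchingOfOCS A f G Γ r).outputs w ω j ≠ some i} = _
  congr 1
  ext ω
  simp only [mem_ofPred_eq, outputs_matchingOfOCS]
  constructor
  · intro h j hj ht
    exact h ⟨j, hj⟩ (by rw [← hWw]; exact ht)
  · intro h j ht
    exact h j j.isLt (by rw [hWw]; exact ht)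

theorem mainTheorem2
    (f f' f'' f''' : ℝ → ℝ)
    (hf_range : ∀ x, 0 ≤ x → f x ∈ Icc (0 : ℝ) 1)
    (hf' : ∀ x, 0 ≤ x → HasDerivWithinAt f (f' x) (Ici 0) x)
    (hf'' : ∀ x, 0 ≤ x → HasDerivWithinAt f' (f'' x) (Ici 0) x)
    (hf''' : ∀ x, 0 ≤ x → HasDerivWithinAt f'' (f''' x) (Ici 0) x)
    (hf_convex : ConvexOn ℝ (Ici 0) f)
    (hf_logconcave : ∀ x, 0 ≤ x → f''' x * f' x ≤ f'' x ^ 2)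
    (hf_lim : Tendsto f atTop (𝓝 0))
    (Γ : ℝ) (hΓ : Γ = 1 - ∫ t in Ioi (0 : ℝ), Real.exp (-t) * f t)
    (r : ℝ) (hr_nonneg : 0 ≤ r)
    (hr : Γ + (1 - Γ) * f' 0 ≠ 0 → r ≤ (-f' 0 - Γ) / (Γ + (1 - Γ) * f' 0))
    (hOCS : ∀ (L : Type) [Fintype L] [Nonempty L],
      ∃ A : ContinuousOCS L, A.HasParameters f r) :
    ∀ (L : Type) [Fintype L] [DecidableEq L],
      ∃ B : OnlineMatchingAlgorithm L, B.IsCompetitive Γ := by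
  intro L _ _
  obtain ⟨G, hG⟩ := exists_isDualProfile f f' f'' f''' hf_range hf' hf'' hf''' hf_convex
    hf_logconcave hf_lim (eval_zero_eq_one_of_OCS hf_range hOCS) Γ hΓ r hr_nonneg hr
  obtain ⟨A, hA⟩ := hOCS (Option L)
  exact ⟨matchingOfOCS A f G Γ r, matchingOfOCS_isCompetitive hG hr_nonneg hA⟩
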